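/- All structures are countable, relational, and have domain $\omega$; a signature has predicates $P_0,P_1,\dots$, with $P_i$ of arity $a(i)$. For a structure $\mathcal M$, $\mathrm{Iso}(\mathcal M)$ is the category whose objects are the structures with domain $\omega$ isomorphic to $\mathcal M$ and whose morphisms are the isomorphisms between them. **Definitions.** An *infinitary interpretation* $\mathcal I$ of $\mathcal A$ in $\mathcal B$ consists of parameter-free $\mathcal L_{\omega_1\omega}$-formulas (for subsets of $\mathcal B^{<\omega}$ or of $(\mathcal B^{<\omega})^{n}$: one formula for each sequence of lengths) that define in $\mathcal B$ a set $Dom_{\mathcal A}^{\mathcal B}\subseteq\mathcal B^{<\omega}$, an equivalence relation $\sim$ on it, and $\sim$-closed relations $R_i\subseteq (Dom_{\mathcal A}^{\mathcal B})^{a(i)}$, together with a map $f_{\mathcal A}^{\mathcal B}\colon Dom_{\mathcal A}^{\mathcal B}\to\mathcal A$ that induces an isomorphism $(Dom_{\mathcal A}^{\mathcal B}/{\sim};R_i/{\sim})\cong\mathcal A$. For $\tilde{\mathcal B}\in\mathrm{Iso}(\mathcal B)$ the same formulas give $Dom_{\mathcal A}^{\tilde{\mathcal B}}$, $\sim$,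 $R_i$ in $\tilde{\mathcal B}$; let $\tau^{\tilde{\mathcal B}}\colon\omega\to Dom_{\mathcal A}^{\tilde{\mathcal B}}/{\sim}$ be the bijection that lists the classes in the order of their least elements, for a fixed effective bijection $\omega\cong\omega^{<\omega}$. The functor $F_{\mathcal I}\colon\mathrm{Iso}(\mathcal B)\to\mathrm{Iso}(\mathcal A)$ sends $\tilde{\mathcal B}$ to the pull-back of $(Dom_{\mathcal A}^{\tilde{\mathcal B}}/{\sim};R_i/{\sim})$ through $\tau^{\tilde{\mathcal B}}$, and $h\colon\tilde{\mathcal B}\to\hat{\mathcal B}$ to $(\tau^{\hat{\mathcal B}})^{-1}\circ\tilde h\circ\tau^{\tilde{\mathcal B}}$, where a tilde on a map denotes the induced map on tuples. An *infinitary bi-interpretation* $(\mathcal I,\mathcal J)$ of $\mathcal A$ and $\mathcal B$ is an interpretation $\mathcal I$ of $\mathcal A$ in $\mathcal B$ and an interpretation $\mathcal J$ of $\mathcal B$ in $\mathcal A$ such that the maps $f_{\mathcal B}^{\mathcal A}\circ\tilde f_{\mathcal A}^{\mathcal B}\colon Dom_{\mathcal B}^{(Dom_{\mathcal A}^{\mathcal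 B})}\to\mathcal B$ and $f_{\mathcal A}^{\mathcal B}\circ\tilde f_{\mathcal B}^{\mathcal A}\colon Dom_{\mathcal A}^{(Dom_{\mathcal B}^{\mathcal A})}\to\mathcal A$ are defined in $\mathcal B$ and $\mathcal A$ by $\mathcal L_{\omega_1\omega}$-formulas; the maps defined by these formulas in copies $\tilde{\mathcal B}$ and $\tilde{\mathcal A}$ are denoted $\varphi^{\tilde{\mathcal B}}$ and $\psi^{\tilde{\mathcal A}}$. Copies and maps are coded as elements of $2^\omega$ by their atomic diagrams and graphs; a morphism $h\colon\mathcal M\to\mathcal N$ is given to an operator as $\mathcal M\oplus h\oplus\mathcal N$. An operator is Borel if it is a Borel map $2^\omega\to2^\omega$; it is $\mathbf\Delta^0_\alpha$ (resp. $\Delta^0_\alpha$) if the bits of its output are, uniformly, both boldface (resp. lightface) $\Sigma^0_\alpha$ and $\Pi^0_\alpha$ in the input; such an operator may be partial and need only be defined on the relevant inputs. An interpretation is $\Delta^{\mathrm{in}}_\alpha$ (resp. $\Delta^{\mathrm c}_\alpha$) if $Dom,\sim,R_0,R_1,\dots$ are definable by both infinitary (resp. uniformly computable infinitary) $\Sigma_\alpha$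 and $\Pi_\alpha$ formulas. A bi-interpretation is $\Delta^{\mathrm{in}}_\alpha$ (resp. $\Delta^{\mathrm c}_\alpha$) if both interpretations are, and both composition maps are definable at this level, that is, the domain and the graph of each are. **Theorem.** Let $(\mathcal I,\mathcal J)$ be an infinitary bi-interpretation of $\mathcal A$ and $\mathcal B$, and put $F=F_{\mathcal I}\colon\mathrm{Iso}(\mathcal B)\to\mathrm{Iso}(\mathcal A)$, $G=F_{\mathcal J}\colon\mathrm{Iso}(\mathcal A)\to\mathrm{Iso}(\mathcal B)$. Write $\tau$ and $\rho$ for the canonical bijections of $\mathcal I$ and $\mathcal J$. There are natural isomorphisms $\eta\colon\mathrm{id}\to GF$ and $\epsilon\colon\mathrm{id}\to FG$ with $$\eta_{\tilde{\mathcal B}}^{-1}=\varphi^{\tilde{\mathcal B}}\circ\tilde\tau^{\tilde{\mathcal B}}\circ\rho^{F(\tilde{\mathcal B})},\qquad \epsilon_{\tilde{\mathcal A}}^{-1}=\psi^{\tilde{\mathcal A}}\circ\tilde\rho^{\tilde{\mathcal A}}\circ\tau^{G(\tilde{\mathcal A})},$$ such that $F,G,\eta,\epsilon$ form a Borel adjoint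 equivalence of categories: $F(\eta_{\tilde{\mathcal B}})=\epsilon_{F(\tilde{\mathcal B})}$ and $G(\epsilon_{\tilde{\mathcal A}})=\eta_{G(\tilde{\mathcal A})}$ for all copies, and $F$, $G$, $\eta$, $\epsilon$ are given by Borel operators. Moreover complexities are preserved: for every ordinal $\alpha\ge1$, if $\mathcal I$ (resp. $\mathcal J$) is $\Delta^{\mathrm{in}}_\alpha$ then $F$ (resp. $G$) is $\mathbf\Delta^0_\alpha$, and if the bi-interpretation is $\Delta^{\mathrm{in}}_\alpha$ then $\eta$ and $\epsilon$ are also $\mathbf\Delta^0_\alpha$; the same holds with $\Delta^{\mathrm c}_\alpha$ and lightface $\Delta^0_\alpha$. -/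

import Mathlib

open CategoryTheory

/-! ### Countable relational structures with domain `ℕ` -/

/-- A structure with domain `ω` in the relational signature with predicates `P₀, P₁, …`, where
`Pᵢ` has arity `a i`. Tuples are lists, so `Pᵢ ⊆ ω^(a i) ⊆ ω^{<ω}`. -/
structure Str (a : ℕ → ℕ) where
  rel : ℕ → Set (List ℕ)
  length_eq : ∀ i l, l ∈ rel i → l.length = a i

/-- Isomorphisms of structures. -/
@[ext]
structure Isom {a : ℕ → ℕ} (M N : Str a) where
  toEquiv : ℕ ≃ ℕ
  map_rel : ∀ i l, l ∈ M.rel i ↔ l.map toEquiv ∈ N.rel i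

namespace Isom

variable {a : ℕ → ℕ} {M N K : Str a}

def refl (M : Str a) : Isom M M := ⟨Equiv.refl ℕ, by simp⟩

def trans (g : Isom M N) (h : Isom N K) : Isom M K :=
  ⟨g.toEquiv.trans h.toEquiv, fun i l => by
    rw [g.map_rel, h.map_rel, List.map_map]; rfl⟩

def symm (h : Isom M N) : Isom N M :=
  ⟨h.toEquiv.symm, fun i l => by
    rw [h.map_rel, List.map_map]; simp⟩

end Isom

/-- The isomorphism class of `A`: the copies of `A` with domain `ω`. -/
structure IsoClass {a : ℕ → ℕ} (A : Str a) where
  str : Str a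
  isom : Nonempty (Isom str A)

/-- The copies of `A` form a category, with the isomorphisms between them as morphisms. -/
instance {a : ℕ → ℕ} (A : Str a) : Category (IsoClass A) where
  Hom M N := Isom M.str N.str
  id M := Isom.refl M.str
  comp g h := g.trans h
  id_comp _ := rfl
  comp_id _ := rfl
  assoc _ _ _ := rfl

/-- The permutation of `ω` underlying a morphism of copies. -/
def homEquiv {a : ℕ → ℕ} {A : Str a} {M N : IsoClass A} (h : M ⟶ N) : ℕ ≃ ℕ :=
  Isom.toEquiv h

/-! ### Formulas of `L_{ω₁ω}` -/

/-- Literals. `((s, some i), v)` is `P_i(x_{v₀}, x_{v₁}, …)` if `s = true` and its negation if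
`s = false`; `((s, none), [m, n])` is `x_m = x_n`, respectively `x_m ≠ x_n`. -/
abbrev Lit : Type := (Bool × Option ℕ) × List ℕ

/-- Finitary quantifier-free formulas, in disjunctive normal form. -/
abbrev QFree : Type := List (List Lit)

def atomHolds {a : ℕ → ℕ} (M : Str a) : Option ℕ → List ℕ → Prop
  | some i, w => w ∈ M.rel i
  | none, w => ∃ x, w = [x, x]

/-- Truth of a literal when `x_n` has the value `l[n]`. A literal that mentions a variable without
a value is false (so that no formula has hidden parameters). -/
def Lit.Holds {a : ℕ → ℕ} (M : Str a) (t : Lit) (l : List ℕ) : Prop :=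
  ∃ w, List.Forall₂ (fun v x => l[v]? = some x) t.2 w ∧ (t.1.1 = true ↔ atomHolds M t.1.2 w)

def QFree.Holds {a : ℕ → ℕ} (M : Str a) (θ : QFree) (l : List ℕ) : Prop :=
  ∃ c ∈ θ, ∀ t ∈ c, Lit.Holds M t l

/-- Formulas of `L_{ω₁ω}` in negation normal form, with quantifiers in blocks:
`disj ψ` is `⋁_{k,j} ∃ y₁ … y_k ψ_{k,j}` and `conj ψ` is `⋀_{k,j} ∀ y₁ … y_k ψ_{k,j}`.
If the free variables of the whole formula are `x₀, …, x_{n-1}`, then `y₁, …, y_k` are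
`x_n, …, x_{n+k-1}` in `ψ_{k,j}`. -/
inductive Fml : Type
  | leaf (θ : QFree) : Fml
  | disj (ψ : ℕ → ℕ → Fml) : Fml
  | conj (ψ : ℕ → ℕ → Fml) : Fml

namespace Fml

/-- `φ.Realize M l` says `M ⊨ φ(l)`. -/
def Realize {a : ℕ → ℕ} (M : Str a) : Fml → List ℕ → Prop
  | leaf θ, l => QFree.Holds M θ l
  | disj ψ, l => ∃ (u : List ℕ) (j : ℕ), (ψ u.length j).Realize M (l ++ u)
  | conj ψ, l => ∀ (u : List ℕ) (j : ℕ), (ψ u.length j).Realize M (l ++ u)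

/-- `φ.HasLevel true α`: `φ` is an infinitary `Σ_α` formula; `φ.HasLevel false α`: it is an
infinitary `Π_α` formula. Level `0` consists of the finitary quantifier-free formulas. -/
def HasLevel : Fml → Bool → Ordinal.{0} → Prop
  | leaf _, _, _ => True
  | disj ψ, true, α => ∀ k j, ∃ β < α, (ψ k j).HasLevel false β
  | conj ψ, false, α => ∀ k j, ∃ β < α, (ψ k j).HasLevel true β
  | disj _, false, _ => False
  | conj _, true, _ => False

/-- The formula as a labelled tree: the label of the node that is reached from the root along a
path (labels below a leaf repeat the leaf). A formula is computable if this function is. -/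
def label : Fml → List (ℕ × ℕ) → QFree ⊕ Bool
  | leaf θ, _ => Sum.inl θ
  | disj _, [] => Sum.inr true
  | conj _, [] => Sum.inr false
  | disj ψ, p :: s => (ψ p.1 p.2).label s
  | conj ψ, p :: s => (ψ p.1 p.2).label s

end Fml

theorem atomHolds_map {a : ℕ → ℕ} {M N : Str a} (h : Isom M N) (o : Option ℕ) (w : List ℕ) :
    atomHolds M o w ↔ atomHolds N o (w.map h.toEquiv) := by
  cases o with
  | some i => exact h.map_rel i w
  | none =>
    constructor
    · rintro ⟨x, rfl⟩; exact ⟨h.toEquiv x, rfl⟩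
    · rintro ⟨x, hx⟩
      refine ⟨h.toEquiv.symm x, ?_⟩
      have := congrArg (List.map h.toEquiv.symm) hx
      simpa using this

theorem Lit.holds_of_map {a : ℕ → ℕ} {M N : Str a} (h : Isom M N) (t : Lit) (l : List ℕ)
    (H : Lit.Holds M t l) : Lit.Holds N t (l.map h.toEquiv) := by
  obtain ⟨w, hw, H⟩ := H
  refine ⟨w.map h.toEquiv, ?_, H.trans (atomHolds_map h _ _)⟩
  rw [List.forall₂_map_right_iff]
  exact hw.imp fun v x hx => by simp [hx]

theorem Isom.map_map_symm {a : ℕ → ℕ} {M N : Str a} (h : Isom M N) (l : List ℕ) :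
    (l.map h.toEquiv).map h.symm.toEquiv = l := by
  simp [Isom.symm]

theorem Isom.map_symm_map {a : ℕ → ℕ} {M N : Str a} (h : Isom M N) (l : List ℕ) :
    (l.map h.symm.toEquiv).map h.toEquiv = l := by
  simp [Isom.symm]

theorem Lit.holds_map {a : ℕ → ℕ} {M N : Str a} (h : Isom M N) (t : Lit) (l : List ℕ) :
    Lit.Holds M t l ↔ Lit.Holds N t (l.map h.toEquiv) :=
  ⟨Lit.holds_of_map h t l, fun H => by
    simpa only [h.map_map_symm] using Lit.holds_of_map h.symm t _ H⟩

/-- Truth of formulas is invariant under isomorphisms. -/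
theorem Fml.realize_map {a : ℕ → ℕ} {M N : Str a} (h : Isom M N) (φ : Fml) (l : List ℕ) :
    φ.Realize M l ↔ φ.Realize N (l.map h.toEquiv) := by
  induction φ generalizing l with
  | leaf θ => simp only [Fml.Realize, QFree.Holds, Lit.holds_map h]
  | disj ψ ih =>
    simp only [Fml.Realize]
    constructor
    · rintro ⟨u, j, H⟩
      exact ⟨u.map h.toEquiv, j, by simpa using (ih _ _ _).1 H⟩
    · rintro ⟨u, j, H⟩
      refine ⟨u.map h.symm.toEquiv, j, (ih _ _ _).2 ?_⟩
      rw [List.map_append, h.map_symm_map, List.length_map]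
      exact H
  | conj ψ ih =>
    simp only [Fml.Realize]
    constructor
    · intro H u j
      have := (ih _ _ _).1 (H (u.map h.symm.toEquiv) j)
      rw [List.map_append, h.map_symm_map, List.length_map] at this
      exact this
    · intro H u j
      refine (ih _ _ _).2 ?_
      simpa using H (u.map h.toEquiv) j

/-! ### Interpretations -/

/-- The formulas of an interpretation. A definable subset of `B^{<ω}` is given by one formula for
each length of tuples, and a definable set of tuples of tuples by one formula for each sequence of
lengths. -/
structure InterpFmls where
  dom : ℕ → Fml
  eqv : ℕ → ℕ → Fml
  rel : ℕ → List ℕ → Fml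

namespace InterpFmls

variable {b : ℕ → ℕ} (S : InterpFmls)

/-- The domain of the interpretation in `M`, a subset of `M^{<ω}`. -/
def Dom (M : Str b) (x : List ℕ) : Prop := (S.dom x.length).Realize M x

/-- The relation `∼` in `M`. -/
def Eqv (M : Str b) (x y : List ℕ) : Prop := (S.eqv x.length y.length).Realize M (x ++ y)

/-- The relation `R_i` in `M`. -/
def Rel (M : Str b) (i : ℕ) (L : List (List ℕ)) : Prop :=
  (S.rel i (L.map List.length)).Realize M L.flatten

/-- `m` is the code of the least tuple of some `∼`-class, for the effective bijection of
`ω` with `ω^{<ω}`. -/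
def IsRep (M : Str b) (m : ℕ) : Prop :=
  S.Dom M (Denumerable.ofNat (List ℕ) m) ∧
    ∀ m' < m, ¬ S.Eqv M (Denumerable.ofNat (List ℕ) m') (Denumerable.ofNat (List ℕ) m)

/-- The canonical bijection `τ` of `ω` with `Dom/∼`: the class `τ(n)` is that of `rep M n`, the
`n`-th tuple that is least in its class. -/
noncomputable def rep (M : Str b) (n : ℕ) : List ℕ :=
  Denumerable.ofNat (List ℕ) (Nat.nth (S.IsRep M) n)

end InterpFmls

/-- An infinitary interpretation of `A` in `B`. The values of `f` outside the domain of the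
interpretation are irrelevant. -/
structure Interp {a b : ℕ → ℕ} (A : Str a) (B : Str b) extends InterpFmls where
  /-- The map `f : Dom → A`. -/
  f : List ℕ → ℕ
  eqv_dom : ∀ x y, toInterpFmls.Eqv B x y → toInterpFmls.Dom B x ∧ toInterpFmls.Dom B y
  eqv_refl : ∀ x, toInterpFmls.Dom B x → toInterpFmls.Eqv B x x
  eqv_symm : ∀ x y, toInterpFmls.Eqv B x y → toInterpFmls.Eqv B y x
  eqv_trans : ∀ x y z, toInterpFmls.Eqv B x y → toInterpFmls.Eqv B y z → toInterpFmls.Eqv B x z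
  rel_dom : ∀ i L, toInterpFmls.Rel B i L → L.length = a i ∧ ∀ x ∈ L, toInterpFmls.Dom B x
  rel_closed : ∀ i L L', List.Forall₂ (toInterpFmls.Eqv B) L L' →
    toInterpFmls.Rel B i L → toInterpFmls.Rel B i L'
  f_surj : ∀ n, ∃ x, toInterpFmls.Dom B x ∧ f x = n
  f_eq_iff : ∀ x y, toInterpFmls.Dom B x → toInterpFmls.Dom B y →
    (f x = f y ↔ toInterpFmls.Eqv B x y)
  f_rel : ∀ i L, L.length = a i → (∀ x ∈ L, toInterpFmls.Dom B x) →
    (toInterpFmls.Rel B i L ↔ L.map f ∈ A.rel i)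

/-! ### The functor of an interpretation -/

namespace InterpFmls

variable {b : ℕ → ℕ} (S : InterpFmls) {M N : Str b}

theorem dom_map (h : Isom M N) (x : List ℕ) : S.Dom M x ↔ S.Dom N (x.map h.toEquiv) := by
  simp only [Dom, List.length_map, Fml.realize_map h]

theorem eqv_map (h : Isom M N) (x y : List ℕ) :
    S.Eqv M x y ↔ S.Eqv N (x.map h.toEquiv) (y.map h.toEquiv) := by
  simp only [Eqv, List.length_map, Fml.realize_map h, List.map_append]

theorem rel_map (h : Isom M N) (i : ℕ) (L : List (List ℕ)) :
    S.Rel M i L ↔ S.Rel N i (L.map (List.map h.toEquiv)) := by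
  have h1 : (L.map (List.map h.toEquiv)).map List.length = L.map List.length := by
    rw [List.map_map]; congr 1; funext l; simp
  rw [Rel, Rel, h1, Fml.realize_map h, List.map_flatten]

end InterpFmls

namespace Interp

variable {a b : ℕ → ℕ} {A : Str a} {B : Str b} (I : Interp A B)

theorem copy_eqv_dom (M : IsoClass B) {x y : List ℕ} (H : I.Eqv M.str x y) :
    I.Dom M.str x ∧ I.Dom M.str y := by
  obtain ⟨h⟩ := M.isom
  rw [I.dom_map h, I.dom_map h]
  exact I.eqv_dom _ _ ((I.eqv_map h _ _).1 H)

theorem copy_refl (M : IsoClass B) {x : List ℕ} (H : I.Dom M.str x) : I.Eqv M.str x x := by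
  obtain ⟨h⟩ := M.isom
  exact (I.eqv_map h _ _).2 (I.eqv_refl _ ((I.dom_map h _).1 H))

theorem copy_symm (M : IsoClass B) {x y : List ℕ} (H : I.Eqv M.str x y) : I.Eqv M.str y x := by
  obtain ⟨h⟩ := M.isom
  exact (I.eqv_map h _ _).2 (I.eqv_symm _ _ ((I.eqv_map h _ _).1 H))

theorem copy_trans (M : IsoClass B) {x y z : List ℕ} (H : I.Eqv M.str x y)
    (H' : I.Eqv M.str y z) : I.Eqv M.str x z := by
  obtain ⟨h⟩ := M.isom
  exact (I.eqv_map h _ _).2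
    (I.eqv_trans _ _ _ ((I.eqv_map h _ _).1 H) ((I.eqv_map h _ _).1 H'))

theorem copy_rel_dom (M : IsoClass B) {i : ℕ} {L : List (List ℕ)} (H : I.Rel M.str i L) :
    L.length = a i ∧ ∀ x ∈ L, I.Dom M.str x := by
  obtain ⟨h⟩ := M.isom
  obtain ⟨h1, h2⟩ := I.rel_dom _ _ ((I.rel_map h _ _).1 H)
  refine ⟨by simpa using h1, fun x hx => (I.dom_map h _).2 (h2 _ (List.mem_map_of_mem hx))⟩

theorem copy_rel_closed (M : IsoClass B) {i : ℕ} {L L' : List (List ℕ)}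
    (H : List.Forall₂ (I.Eqv M.str) L L') (HL : I.Rel M.str i L) : I.Rel M.str i L' := by
  obtain ⟨h⟩ := M.isom
  refine (I.rel_map h _ _).2 (I.rel_closed i _ _ ?_ ((I.rel_map h _ _).1 HL))
  rw [List.forall₂_map_left_iff, List.forall₂_map_right_iff]
  exact H.imp fun x y hxy => (I.eqv_map h _ _).1 hxy

/-- The interpretation of `A` in a copy of `B`. -/
theorem copy_f (M : IsoClass B) : ∃ g : List ℕ → ℕ,
    (∀ n, ∃ x, I.Dom M.str x ∧ g x = n) ∧
    (∀ x y, I.Dom M.str x → I.Dom M.str y → (g x = g y ↔ I.Eqv M.str x y)) ∧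
    (∀ i L, L.length = a i → (∀ x ∈ L, I.Dom M.str x) →
      (I.Rel M.str i L ↔ L.map g ∈ A.rel i)) := by
  obtain ⟨h⟩ := M.isom
  refine ⟨fun x => I.f (x.map h.toEquiv), fun n => ?_, fun x y hx hy => ?_, fun i L hL hd => ?_⟩
  · obtain ⟨x, hx, rfl⟩ := I.f_surj n
    refine ⟨x.map h.symm.toEquiv, (I.dom_map h _).2 ?_, ?_⟩
    · rwa [h.map_symm_map]
    · simp only [h.map_symm_map]
  · rw [I.f_eq_iff _ _ ((I.dom_map h _).1 hx) ((I.dom_map h _).1 hy), ← I.eqv_map h]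
  · rw [I.rel_map h, I.f_rel i _ (by simpa using hL), List.map_map]
    · rfl
    · intro x hx
      obtain ⟨y, hy, rfl⟩ := List.mem_map.1 hx
      exact (I.dom_map h _).1 (hd y hy)

theorem exists_isRep (M : IsoClass B) {x : List ℕ} (hx : I.Dom M.str x) :
    ∃ m, I.IsRep M.str m ∧ I.Eqv M.str x (Denumerable.ofNat (List ℕ) m) := by
  classical
  have hex : ∃ m, I.Eqv M.str x (Denumerable.ofNat (List ℕ) m) :=
    ⟨Encodable.encode x, by simpa using I.copy_refl M hx⟩
  refine ⟨Nat.find hex, ⟨(I.copy_eqv_dom M (Nat.find_spec hex)).2, fun m' hm' H => ?_⟩,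
    Nat.find_spec hex⟩
  exact Nat.find_min hex hm' (I.copy_trans M (Nat.find_spec hex) (I.copy_symm M H))

theorem isRep_unique (M : IsoClass B) {m m' : ℕ} (hm : I.IsRep M.str m) (hm' : I.IsRep M.str m')
    (H : I.Eqv M.str (Denumerable.ofNat (List ℕ) m) (Denumerable.ofNat (List ℕ) m')) :
    m = m' := by
  rcases lt_trichotomy m m' with h | h | h
  · exact (hm'.2 m h H).elim
  · exact h
  · exact (hm.2 m' h (I.copy_symm M H)).elim

theorem infinite_isRep (M : IsoClass B) : (Set.ofPred (I.IsRep M.str)).Infinite := by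
  obtain ⟨g, hs, he, -⟩ := I.copy_f M
  have hsurj : Set.SurjOn (fun m => g (Denumerable.ofNat (List ℕ) m))
      (Set.ofPred (I.IsRep M.str)) Set.univ := by
    intro n _
    obtain ⟨x, hx, rfl⟩ := hs n
    obtain ⟨m, hm, hxm⟩ := I.exists_isRep M hx
    exact ⟨m, hm, ((he _ _ hx hm.1).2 hxm).symm⟩
  exact fun hfin => Set.infinite_univ ((hfin.image _).subset hsurj)

theorem rep_dom (M : IsoClass B) (n : ℕ) : I.Dom M.str (I.rep M.str n) :=
  (Nat.nth_mem_of_infinite (I.infinite_isRep M) n).1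

theorem rep_inj (M : IsoClass B) {n m : ℕ}
    (H : I.Eqv M.str (I.rep M.str n) (I.rep M.str m)) : n = m :=
  Nat.nth_injective (I.infinite_isRep M) (I.isRep_unique M
    (Nat.nth_mem_of_infinite (I.infinite_isRep M) n)
    (Nat.nth_mem_of_infinite (I.infinite_isRep M) m) H)

theorem rep_surj (M : IsoClass B) {x : List ℕ} (hx : I.Dom M.str x) :
    ∃ n, I.Eqv M.str x (I.rep M.str n) := by
  obtain ⟨m, hm, hxm⟩ := I.exists_isRep M hx
  have : m ∈ Set.range (Nat.nth (I.IsRep M.str)) := by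
    rw [Nat.range_nth_of_infinite (I.infinite_isRep M)]; exact hm
  obtain ⟨n, rfl⟩ := this
  exact ⟨n, hxm⟩

/-- The copy of `A` with domain `ω` that the interpretation yields in a copy `M` of `B`: the
pull-back through `τ` of the structure with domain `Dom/∼` and relations `R_i/∼`. -/
def objStr (M : IsoClass B) : Str a where
  rel i := {k | I.Rel M.str i (k.map (I.rep M.str))}
  length_eq i k hk := by simpa using (I.copy_rel_dom M hk).1

theorem objStr_isom (M : IsoClass B) : Nonempty (Isom (I.objStr M) A) := by
  obtain ⟨g, hs, he, hr⟩ := I.copy_f M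
  have hb : Function.Bijective fun n => g (I.rep M.str n) := by
    constructor
    · intro n m hnm
      exact I.rep_inj M ((he _ _ (I.rep_dom M n) (I.rep_dom M m)).1 hnm)
    · intro n
      obtain ⟨x, hx, rfl⟩ := hs n
      obtain ⟨m, hm⟩ := I.rep_surj M hx
      exact ⟨m, ((he _ _ hx (I.rep_dom M m)).2 hm).symm⟩
  refine ⟨⟨Equiv.ofBijective _ hb, fun i k => ?_⟩⟩
  have key : k.length = a i → (I.Rel M.str i (k.map (I.rep M.str)) ↔
      k.map (fun n => g (I.rep M.str n)) ∈ A.rel i) := by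
    intro hk
    rw [hr i _ (by simpa using hk), List.map_map]
    · rfl
    · intro x hx
      obtain ⟨n, -, rfl⟩ := List.mem_map.1 hx
      exact I.rep_dom M n
  change I.Rel M.str i (k.map (I.rep M.str)) ↔ k.map (fun n => g (I.rep M.str n)) ∈ A.rel i
  constructor
  · intro H
    exact (key (by simpa using (I.copy_rel_dom M H).1)).1 H
  · intro H
    exact (key (by simpa using A.length_eq _ _ H)).2 H

/-- The action of the functor on objects. -/
def obj (M : IsoClass B) : IsoClass A := ⟨I.objStr M, I.objStr_isom M⟩

theorem exists_map {M N : IsoClass B} (h : M ⟶ N) (n : ℕ) :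
    ∃ m, I.Eqv N.str ((I.rep M.str n).map (homEquiv h)) (I.rep N.str m) :=
  I.rep_surj N ((I.dom_map h _).1 (I.rep_dom M n))

/-- The map `τ⁻¹ ∘ h̃ ∘ τ`. -/
noncomputable def mapFun {M N : IsoClass B} (h : M ⟶ N) (n : ℕ) : ℕ :=
  (I.exists_map h n).choose

theorem mapFun_spec {M N : IsoClass B} (h : M ⟶ N) (n : ℕ) :
    I.Eqv N.str ((I.rep M.str n).map (homEquiv h)) (I.rep N.str (I.mapFun h n)) :=
  (I.exists_map h n).choose_spec

theorem mapFun_eq {M N : IsoClass B} (h : M ⟶ N) {n m : ℕ}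
    (H : I.Eqv N.str ((I.rep M.str n).map (homEquiv h)) (I.rep N.str m)) : I.mapFun h n = m :=
  I.rep_inj N (I.copy_trans N (I.copy_symm N (I.mapFun_spec h n)) H)

theorem mapFun_id (M : IsoClass B) (n : ℕ) : I.mapFun (𝟙 M) n = n := by
  apply I.mapFun_eq
  have : (I.rep M.str n).map (homEquiv (𝟙 M)) = I.rep M.str n := List.map_id _
  rw [this]
  exact I.copy_refl M (I.rep_dom M n)

theorem mapFun_comp {M N K : IsoClass B} (g : M ⟶ N) (h : N ⟶ K) (n : ℕ) :
    I.mapFun (g ≫ h) n = I.mapFun h (I.mapFun g n) := by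
  apply I.mapFun_eq
  have h1 := (I.eqv_map h _ _).1 (I.mapFun_spec g n)
  have h2 := I.mapFun_spec h (I.mapFun g n)
  have h3 : (I.rep M.str n).map (homEquiv (g ≫ h)) =
      ((I.rep M.str n).map (homEquiv g)).map (homEquiv h) := by
    rw [List.map_map]; rfl
  rw [h3]
  exact I.copy_trans K h1 h2

/-- The action of the functor on morphisms. -/
noncomputable def map {M N : IsoClass B} (h : M ⟶ N) : I.obj M ⟶ I.obj N where
  toEquiv :=
    { toFun := I.mapFun h
      invFun := I.mapFun (M := N) (N := M) (Isom.symm h)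
      left_inv := fun n => by
        rw [← I.mapFun_comp]
        have : h ≫ (show N ⟶ M from Isom.symm h) = 𝟙 M :=
          Isom.ext (Equiv.self_trans_symm (Isom.toEquiv h))
        rw [this, I.mapFun_id]
      right_inv := fun n => by
        rw [← I.mapFun_comp]
        have : (show N ⟶ M from Isom.symm h) ≫ h = 𝟙 N :=
          Isom.ext (Equiv.symm_trans_self (Isom.toEquiv h))
        rw [this, I.mapFun_id] }
  map_rel i k := by
    change I.Rel M.str i (k.map (I.rep M.str)) ↔
      I.Rel N.str i ((k.map (I.mapFun h)).map (I.rep N.str))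
    rw [I.rel_map h]
    have key : List.Forall₂ (I.Eqv N.str) ((k.map (I.rep M.str)).map (List.map (homEquiv h)))
        ((k.map (I.mapFun h)).map (I.rep N.str)) := by
      simp only [List.forall₂_map_left_iff, List.forall₂_map_right_iff]
      exact List.forall₂_same.2 fun n _ => I.mapFun_spec h n
    exact ⟨I.copy_rel_closed N key,
      I.copy_rel_closed N (key.flip.imp fun _ _ => I.copy_symm N)⟩

/-- The functor `F_I` from the copies of `B` to the copies of `A`, for an interpretation `I` of
`A` in `B`. -/
noncomputable def functor : IsoClass B ⥤ IsoClass A where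
  obj := I.obj
  map := I.map
  map_id M := Isom.ext (Equiv.ext fun n => I.mapFun_id M n)
  map_comp g h := Isom.ext (Equiv.ext fun n => I.mapFun_comp g h n)

end Interp

/-! ### Bi-interpretations -/

/-- `J` is an interpretation in `A` and `I` is an interpretation of `A` in some structure.
`I.IterDom J L` says that the tuple `L` of tuples lies in the iterated domain
`Dom_B^{(Dom_A^B)} ⊆ (Dom_A^B)^{<ω}`. -/
def Interp.IterDom {a b c : ℕ → ℕ} {A : Str a} {B : Str b} {C : Str c} (I : Interp A B)
    (J : Interp C A) (L : List (List ℕ)) : Prop :=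
  (∀ x ∈ L, I.Dom B x) ∧ J.Dom A (L.map I.f)

/-- The relation defined by a family of formulas (one for each sequence of lengths) between tuples
of tuples and elements of `M`. -/
def CompHolds {b : ℕ → ℕ} (φ : List ℕ → Fml) (M : Str b) (L : List (List ℕ)) (n : ℕ) : Prop :=
  (φ (L.map List.length)).Realize M (L.flatten ++ [n])

/-- An infinitary bi-interpretation of `A` and `B`: an interpretation `I` of `A` in `B`, an
interpretation `J` of `B` in `A`, and formulas that define the maps
`f_J ∘ f̃_I : Dom_B^{(Dom_A^B)} → B` in `B` and `f_I ∘ f̃_J : Dom_A^{(Dom_B^A)} → A` in `A`. -/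
structure BiInterp {a b : ℕ → ℕ} (A : Str a) (B : Str b) where
  I : Interp A B
  J : Interp B A
  compB : List ℕ → Fml
  compA : List ℕ → Fml
  compB_iff : ∀ L n, CompHolds compB B L n ↔ I.IterDom J L ∧ J.f (L.map I.f) = n
  compA_iff : ∀ L n, CompHolds compA A L n ↔ J.IterDom I L ∧ I.f (L.map J.f) = n

/-! ### Operators on Cantor space -/

open Classical in
/-- The atomic diagram of a structure, as a point of Cantor space. -/
noncomputable def Str.code {a : ℕ → ℕ} (M : Str a) : ℕ → Bool := fun n =>
  decide ((Denumerable.ofNat (ℕ × List ℕ) n).2 ∈ M.rel (Denumerable.ofNat (ℕ × List ℕ) n).1)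

/-- The graph of a function on `ω`, as a point of Cantor space. -/
def graphCode (h : ℕ → ℕ) : ℕ → Bool := fun n => decide (h n.unpair.1 = n.unpair.2)

/-- The join `X ⊕ Y`. -/
def cantorJoin (X Y : ℕ → Bool) : ℕ → Bool := fun n => if n % 2 = 0 then X (n / 2) else Y (n / 2)

/-- Codes for Borel subsets of Cantor space. A leaf is a clopen set in disjunctive normal form,
where the literal `(n, s)` stands for the set of all `X` with `X n = s`. -/
inductive BorelCode : Type
  | leaf (θ : List (List (ℕ × Bool))) : BorelCode
  | disj (c : ℕ → BorelCode) : BorelCode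
  | conj (c : ℕ → BorelCode) : BorelCode

namespace BorelCode

/-- Membership in the set with a given code: `disj` is union and `conj` is intersection. -/
def Holds : BorelCode → (ℕ → Bool) → Prop
  | leaf θ, X => ∃ c ∈ θ, ∀ t ∈ c, X t.1 = t.2
  | disj c, X => ∃ i, (c i).Holds X
  | conj c, X => ∀ i, (c i).Holds X

/-- `c.HasLevel true α`: `c` is a code for a `Σ⁰_α` set; `c.HasLevel false α`: for a `Π⁰_α` set. -/
def HasLevel : BorelCode → Bool → Ordinal.{0} → Prop
  | leaf _, _, _ => True
  | disj c, true, α => ∀ i, ∃ β < α, (c i).HasLevel false β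
  | conj c, false, α => ∀ i, ∃ β < α, (c i).HasLevel true β
  | disj _, false, _ => False
  | conj _, true, _ => False

/-- The code as a labelled tree. It is computable if this function is. -/
def label : BorelCode → List ℕ → List (List (ℕ × Bool)) ⊕ Bool
  | leaf θ, _ => Sum.inl θ
  | disj _, [] => Sum.inr true
  | conj _, [] => Sum.inr false
  | disj c, i :: s => (c i).label s
  | conj c, i :: s => (c i).label s

end BorelCode

/-- The two kinds of complexity: `boldface` (arbitrary infinitary formulas and Borel codes) and
`lightface` (computable ones). -/
inductive Face : Type
  | boldface : Face
  | lightface : Face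

/-- The family `S` of relations on `M^{<ω}` is definable in `M`, uniformly, by formulas that are
`Δ_α` (both `Σ_α` and `Π_α`); in the lightface case, by a computable family of computable
formulas. -/
def DeltaDefinable {b : ℕ → ℕ} (F : Face) (α : Ordinal.{0}) (M : Str b)
    (S : ℕ → Set (List (List ℕ))) : Prop :=
  ∃ σ π : ℕ → List ℕ → Fml,
    (∀ i s, (σ i s).HasLevel true α ∧ (π i s).HasLevel false α) ∧
    (F = Face.lightface →
      Computable (fun p : (ℕ × List ℕ) × List (ℕ × ℕ) => (σ p.1.1 p.1.2).label p.2) ∧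
      Computable (fun p : (ℕ × List ℕ) × List (ℕ × ℕ) => (π p.1.1 p.1.2).label p.2)) ∧
    ∀ i L, (L ∈ S i ↔ (σ i (L.map List.length)).Realize M L.flatten) ∧
      (L ∈ S i ↔ (π i (L.map List.length)).Realize M L.flatten)

/-- The relations `Dom`, `∼`, `R₀`, `R₁`, … of an interpretation in `B`, as one family. -/
def Interp.relations {a b : ℕ → ℕ} {A : Str a} {B : Str b} (I : Interp A B) :
    ℕ → Set (List (List ℕ))
  | 0 => {L | ∃ x, L = [x] ∧ I.Dom B x}
  | 1 => {L | ∃ x y, L = [x, y] ∧ I.Eqv B x y}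
  | i + 2 => {L | I.Rel B i L}

/-- The interpretation `I` is `Δ_α`. -/
def Interp.IsDelta {a b : ℕ → ℕ} {A : Str a} {B : Str b} (I : Interp A B) (F : Face)
    (α : Ordinal.{0}) : Prop :=
  DeltaDefinable F α B I.relations

/-- The map `f_J ∘ f̃_I : Dom_B^{(Dom_A^B)} → B` is `Δ_α`-definable in `B`: its domain and its
graph are. -/
def Interp.CompIsDelta {a b : ℕ → ℕ} {A : Str a} {B : Str b} (I : Interp A B) (J : Interp B A)
    (F : Face) (α : Ordinal.{0}) : Prop :=
  DeltaDefinable F α B (fun _ => {L | I.IterDom J L}) ∧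
    DeltaDefinable F α B
      (fun _ => {K | ∃ L n, K = L ++ [[n]] ∧ I.IterDom J L ∧ J.f (L.map I.f) = n})

/-- The bi-interpretation is `Δ_α`: both interpretations and both composition maps are. -/
def BiInterp.IsDelta {a b : ℕ → ℕ} {A : Str a} {B : Str b} (P : BiInterp A B) (F : Face)
    (α : Ordinal.{0}) : Prop :=
  P.I.IsDelta F α ∧ P.J.IsDelta F α ∧ P.I.CompIsDelta P.J F α ∧ P.J.CompIsDelta P.I F α

/-- The assignment `inp t ↦ out t` is given by a Borel operator on Cantor space. -/
def IsBorelOp {T : Type} (inp out : T → ℕ → Bool) : Prop :=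
  ∃ Φ : (ℕ → Bool) → (ℕ → Bool), Measurable Φ ∧ ∀ t, Φ (inp t) = out t

/-- The assignment `inp t ↦ out t` is given by a `Δ⁰_α` operator: `out t` is `Δ⁰_α` in `inp t`,
uniformly. As usual (for `α = 1` these are the Turing functionals) the operator may be partial, and
is only required to work on the points `inp t`. -/
def IsDeltaOp {T : Type} (F : Face) (α : Ordinal.{0}) (inp out : T → ℕ → Bool) : Prop :=
  ∃ σ π : ℕ → BorelCode,
    (∀ n, (σ n).HasLevel true α ∧ (π n).HasLevel false α) ∧
    (F = Face.lightface →
      Computable (fun p : ℕ × List ℕ => (σ p.1).label p.2) ∧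
      Computable (fun p : ℕ × List ℕ => (π p.1).label p.2)) ∧
    ∀ t n, (out t n = true ↔ (σ n).Holds (inp t)) ∧ (out t n = true ↔ (π n).Holds (inp t))

section Operators

variable {a b : ℕ → ℕ} {A : Str a} {B : Str b}

/-- A morphism `h : M → N` between copies of `B`, with its source and target. -/
abbrev Mor (B : Str b) : Type := Σ M N : IsoClass B, (M ⟶ N)

/-- A morphism `h : M → N` as a point of Cantor space: `M ⊕ h ⊕ N`. -/
noncomputable def Mor.code (t : Mor B) : ℕ → Bool :=
  cantorJoin t.1.str.code (cantorJoin (graphCode (homEquiv t.2.2)) t.2.1.str.code)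

/-- A functor is Borel if it is given by Borel operators on objects and on morphisms. -/
def IsBorelFunctor (F : IsoClass B ⥤ IsoClass A) : Prop :=
  IsBorelOp (fun M : IsoClass B => M.str.code) (fun M => (F.obj M).str.code) ∧
    IsBorelOp (fun t : Mor B => t.code) (fun t => graphCode (homEquiv (F.map t.2.2)))

/-- A functor is `Δ⁰_α` if it is given by `Δ⁰_α` operators on objects and on morphisms. -/
def IsDeltaFunctor (E : Face) (α : Ordinal.{0}) (F : IsoClass B ⥤ IsoClass A) : Prop :=
  IsDeltaOp E α (fun M : IsoClass B => M.str.code) (fun M => (F.obj M).str.code) ∧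
    IsDeltaOp E α (fun t : Mor B => t.code) (fun t => graphCode (homEquiv (F.map t.2.2)))

/-- A natural isomorphism `M → F M` is Borel if it is given by a Borel operator. -/
def IsBorelNatIso {F : IsoClass B ⥤ IsoClass B} (η : 𝟭 (IsoClass B) ≅ F) : Prop :=
  IsBorelOp (fun M : IsoClass B => M.str.code) (fun M => graphCode (homEquiv (η.hom.app M)))

/-- A natural isomorphism `M → F M` is `Δ⁰_α` if it is given by a `Δ⁰_α` operator. -/
def IsDeltaNatIso (E : Face) (α : Ordinal.{0}) {F : IsoClass B ⥤ IsoClass B}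
    (η : 𝟭 (IsoClass B) ≅ F) : Prop :=
  IsDeltaOp E α (fun M : IsoClass B => M.str.code)
    (fun M => graphCode (homEquiv (η.hom.app M)))

/-- The functors `F`, `G` and the natural isomorphisms `η : 1 → GF`, `ε : 1 → FG` form an adjoint
equivalence of categories. -/
def IsAdjointEquivalence (F : IsoClass B ⥤ IsoClass A) (G : IsoClass A ⥤ IsoClass B)
    (η : 𝟭 (IsoClass B) ≅ F ⋙ G) (ε : 𝟭 (IsoClass A) ≅ G ⋙ F) : Prop :=
  (∀ M, F.map (η.hom.app M) = ε.hom.app (F.obj M)) ∧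
    ∀ N, G.map (ε.hom.app N) = η.hom.app (G.obj N)

/-- An adjoint equivalence is Borel if its two functors and its two natural isomorphisms are. -/
def IsBorelAdjointEquivalence (F : IsoClass B ⥤ IsoClass A) (G : IsoClass A ⥤ IsoClass B)
    (η : 𝟭 (IsoClass B) ≅ F ⋙ G) (ε : 𝟭 (IsoClass A) ≅ G ⋙ F) : Prop :=
  IsAdjointEquivalence F G η ε ∧ IsBorelFunctor F ∧ IsBorelFunctor G ∧
    IsBorelNatIso η ∧ IsBorelNatIso ε

/-- The natural isomorphism `η : 1 → F_J F_I` is built from the composition map that is defined by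
the formulas `φ`: for each copy `M` of `B`, the inverse of `η_M` is `φ^M ∘ τ̃ ∘ ρ`, where
`ρ` is the canonical bijection from the domain of `F_J (F_I M)` to `Dom_B^{F_I M}/∼`, and `τ` the
one from the domain of `F_I M` to `Dom_A^M/∼`. -/
def IsBuiltFrom (I : Interp A B) (J : Interp B A) (φ : List ℕ → Fml)
    (η : 𝟭 (IsoClass B) ≅ I.functor ⋙ J.functor) : Prop :=
  ∀ (M : IsoClass B) (n : ℕ), CompHolds φ M.str
    ((J.rep (I.functor.obj M).str (homEquiv (η.hom.app M) n)).map (I.rep M.str)) n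

end Operators

/-! Existence of η and ε. An isomorphism h of a copy M with B induces the isomorphism n ↦
f(h̃(τ(n))) of F(M) with A (`Interp.objIso`). The same step for J gives an isomorphism of GF(M) with
B, and h⁻¹ leads back to M (`BiInterp.counit`). Evaluated in M, the formula for the composition map
defines this very map, and it does not mention h; hence the choice of h does not matter
(`BiInterp.counit_eq`). This freedom gives everything else: for naturality along g : M → N, take h'
on N and h' ∘ g on M; for F(η) = ε, take on F(M) the isomorphism induced by the one on M.

Complexity. Formulas translate into Borel codes level by level and computably (`Fml.toBorel`), so
Δ_α-definable relations are uniformly Δ⁰_α in the copies (`DeltaDefinable.deltaFam`). For α ≥ 1,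
uniformly Σ⁰_α families are closed under effective countable unions of finite intersections
(`SigmaFam.unionInter`), hence under substitution of total functions with Σ⁰_α graphs, and such
graphs are Δ⁰_α (`DeltaFam.of_graph`). The graph of τ is Σ⁰_α, since finitely many Δ⁰_α facts
certify a value (`InterpFmls.deltaFam_rep`). This settles F and G.

For η one needs ρ in F(M), and evaluating the formulas of J in F(M) could raise the level. Instead,
through τ, the domain of J in F(M) is the domain of the composition map in M, and ∼ is the kernel of
that map; both are Δ⁰_α in M by hypothesis (`BiInterp.deltaFam_dom`, `BiInterp.deltaFam_eqv`).

Borelness is the boldface case at a large α: countably many formulas have a common bound on their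
levels (`BiInterp.exists_isDelta`). -/

/-! ### Computable functions on lists -/

namespace Computable

variable {α β σ : Type*} [Primcodable α] [Primcodable β] [Primcodable σ]

/-- The fold is a primitive recursion on the number of entries already read. The default value in a
step keeps the accumulator and is never reached within the length of the list. -/
theorem list_foldl {f : α → List β} {g : α → σ} {h : α → σ × β → σ} (hf : Computable f)
    (hg : Computable g) (hh : Computable₂ h) :
    Computable fun x => (f x).foldl (fun s b => h x (s, b)) (g x) := by
  have step : Computable₂ fun (x : α) (p : ℕ × σ) =>
      (((f x)[p.1]?).map fun b => h x (p.2, b)).getD p.2 := by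
    refine Computable.option_getD (Computable.option_map ?_ ?_) ?_
    · exact Computable.list_getElem?.comp (hf.comp Computable.fst)
        (Computable.fst.comp Computable.snd)
    · exact hh.comp (Computable.fst.comp Computable.fst)
        (Computable.pair (Computable.snd.comp (Computable.snd.comp Computable.fst)) Computable.snd)
    · exact Computable.snd.comp Computable.snd
  refine (Computable.nat_rec (Computable.list_length.comp hf) hg step).of_eq fun x => ?_
  have key : ∀ n, n ≤ (f x).length →
      (Nat.rec (g x) (fun n IH => (((f x)[n]?).map fun b => h x (IH, b)).getD IH) n : σ) =
        ((f x).take n).foldl (fun s b => h x (s, b)) (g x) := by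
    intro n
    induction n with
    | zero => intro _; simp
    | succ n ih =>
      intro hn
      have hn' : n < (f x).length := hn
      rw [List.take_succ_eq_append_getElem hn', List.foldl_append, ← ih hn'.le]
      simp [List.getElem?_eq_getElem hn']
  simpa using key _ le_rfl

theorem list_map {f : α → List β} {g : α → β → σ} (hf : Computable f) (hg : Computable₂ g) :
    Computable fun x => (f x).map (g x) := by
  have : Computable fun x => (f x).foldl (fun (s : List σ) b => s ++ [g x b]) [] := by
    refine Computable.list_foldl (h := fun x p => p.1 ++ [g x p.2]) hf (Computable.const []) ?_
    exact Computable.list_concat.comp (Computable.fst.comp Computable.snd)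
      (hg.comp Computable.fst (Computable.snd.comp Computable.snd))
  refine this.of_eq fun x => ?_
  have key : ∀ (l : List β) (s : List σ),
      l.foldl (fun (s : List σ) b => s ++ [g x b]) s = s ++ l.map (g x) := by
    intro l
    induction l with
    | nil => simp
    | cons b l ih => intro s; simp [ih]
  simpa using key (f x) []

end Computable

/-! ### Quantifier-free formulas on Cantor space -/

/-- Clopen subsets of Cantor space in disjunctive normal form. -/
abbrev Clopen : Type := List (List (ℕ × Bool))

namespace Clopen

def Holds (θ : Clopen) (X : ℕ → Bool) : Prop := ∃ c ∈ θ, ∀ t ∈ c, X t.1 = t.2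

def inter (θ θ' : Clopen) : Clopen := θ.flatMap fun c => θ'.map fun d => c ++ d

def interList (Θ : List Clopen) : Clopen := Θ.foldr inter [[]]

/-- De Morgan: each clause becomes the union of its negated literals, and these unions are
intersected. -/
def compl (θ : Clopen) : Clopen := interList (θ.map fun c => c.map fun t => [(t.1, !t.2)])

theorem holds_inter (θ θ' : Clopen) (X : ℕ → Bool) :
    (θ.inter θ').Holds X ↔ θ.Holds X ∧ θ'.Holds X := by
  simp only [Holds, inter, List.mem_flatMap, List.mem_map]
  constructor
  · rintro ⟨_, ⟨c, hc, d, hd, rfl⟩, H⟩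
    exact ⟨⟨c, hc, fun t ht => H t (List.mem_append_left _ ht)⟩,
      ⟨d, hd, fun t ht => H t (List.mem_append_right _ ht)⟩⟩
  · rintro ⟨⟨c, hc, H⟩, d, hd, H'⟩
    refine ⟨c ++ d, ⟨c, hc, d, hd, rfl⟩, fun t ht => ?_⟩
    rcases List.mem_append.1 ht with h | h
    exacts [H t h, H' t h]

theorem holds_interList (Θ : List Clopen) (X : ℕ → Bool) :
    (interList Θ).Holds X ↔ ∀ θ ∈ Θ, θ.Holds X := by
  induction Θ with
  | nil => simp [interList, Holds]
  | cons θ Θ ih => rw [List.forall_mem_cons, ← ih]; exact holds_inter _ _ _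

theorem holds_compl (θ : Clopen) (X : ℕ → Bool) : θ.compl.Holds X ↔ ¬ θ.Holds X := by
  rw [compl, holds_interList, List.forall_mem_map, Holds]
  push Not
  refine forall₂_congr fun c _ => ?_
  simp only [Holds, List.mem_map]
  constructor
  · rintro ⟨_, ⟨t, ht, rfl⟩, H⟩
    exact ⟨t, ht, Bool.eq_not.1 (H _ List.mem_cons_self)⟩
  · rintro ⟨t, ht, H⟩
    exact ⟨_, ⟨t, ht, rfl⟩, by simpa using Bool.eq_not.2 H⟩

theorem primrec_inter : Primrec₂ inter := by
  refine Primrec.list_flatMap Primrec.fst ?_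
  refine Primrec.list_map (Primrec.snd.comp Primrec.fst) ?_
  exact Primrec.list_append.comp (Primrec.snd.comp Primrec.fst) Primrec.snd

theorem primrec_interList : Primrec interList :=
  Primrec.list_foldr (h := fun _ p => inter p.1 p.2) Primrec.id (Primrec.const _)
    (primrec_inter.comp (Primrec.fst.comp Primrec.snd) (Primrec.snd.comp Primrec.snd))

theorem primrec_compl : Primrec compl := by
  refine primrec_interList.comp (Primrec.list_map Primrec.id ?_)
  refine Primrec.list_map Primrec.snd ?_
  refine Primrec.list_cons.comp (Primrec.pair (Primrec.fst.comp Primrec.snd)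
    (Primrec.not.comp (Primrec.snd.comp Primrec.snd))) (Primrec.const [])

end Clopen

/-! ### Operations on Borel codes -/

namespace BorelCode

def compl : BorelCode → BorelCode
  | leaf θ => leaf (Clopen.compl θ)
  | disj c => conj fun i => (c i).compl
  | conj c => disj fun i => (c i).compl

theorem holds_compl (c : BorelCode) (X : ℕ → Bool) : c.compl.Holds X ↔ ¬ c.Holds X := by
  induction c with
  | leaf θ => exact Clopen.holds_compl θ X
  | disj c ih => simp [compl, Holds, ih]
  | conj c ih => simp [compl, Holds, ih]

theorem HasLevel.compl {c : BorelCode} {s : Bool} {α : Ordinal.{0}} (h : c.HasLevel s α) :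
    c.compl.HasLevel (!s) α := by
  induction c generalizing s α with
  | leaf θ => trivial
  | disj c ih =>
    cases s with
    | false => exact h.elim
    | true => exact fun i => let ⟨β, hβ, H⟩ := h i; ⟨β, hβ, ih i H⟩
  | conj c ih =>
    cases s with
    | true => exact h.elim
    | false => exact fun i => let ⟨β, hβ, H⟩ := h i; ⟨β, hβ, ih i H⟩

theorem label_compl (c : BorelCode) (s : List ℕ) :
    c.compl.label s = (c.label s).map Clopen.compl not := by
  induction c generalizing s with
  | leaf θ => cases s <;> rfl
  | disj c ih => cases s <;> simp [BorelCode.compl, label, ih]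
  | conj c ih => cases s <;> simp [BorelCode.compl, label, ih]

theorem HasLevel.mono {c : BorelCode} {s : Bool} {α β : Ordinal.{0}} (h : c.HasLevel s α)
    (hαβ : α ≤ β) : c.HasLevel s β := by
  cases c with
  | leaf θ => trivial
  | disj c =>
    cases s with
    | false => exact h
    | true => exact fun i => let ⟨γ, hγ, H⟩ := h i; ⟨γ, hγ.trans_le hαβ, H⟩
  | conj c =>
    cases s with
    | true => exact h
    | false => exact fun i => let ⟨γ, hγ, H⟩ := h i; ⟨γ, hγ.trans_le hαβ, H⟩

/-- The subtree at an immediate successor of the root; leaves are repeated. -/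
def child : BorelCode → ℕ → BorelCode
  | leaf θ, _ => leaf θ
  | disj c, i => c i
  | conj c, i => c i

theorem label_cons (c : BorelCode) (i : ℕ) (s : List ℕ) :
    c.label (i :: s) = (c.child i).label s := by
  cases c with
  | leaf θ => cases s <;> rfl
  | disj c => rfl
  | conj c => rfl

theorem HasLevel.child {c : BorelCode} {s : Bool} {α : Ordinal.{0}} (h : c.HasLevel s α)
    (hα : 0 < α) (i : ℕ) : ∃ β < α, (c.child i).HasLevel (!s) β := by
  cases c with
  | leaf θ => exact ⟨0, hα, trivial⟩
  | disj c =>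
    cases s with
    | false => exact h.elim
    | true => exact h i
  | conj c =>
    cases s with
    | true => exact h.elim
    | false => exact h i

/-- A leaf is the union of copies of itself, so leaves need no separate treatment when a Σ code is
unfolded. -/
theorem holds_iff_exists_child {c : BorelCode} {α : Ordinal.{0}} (h : c.HasLevel true α)
    (X : ℕ → Bool) : c.Holds X ↔ ∃ i, (c.child i).Holds X := by
  cases c with
  | leaf θ => simp [BorelCode.child]
  | disj c => rfl
  | conj c => exact h.elim

theorem holds_iff_forall_child {c : BorelCode} {α : Ordinal.{0}} (h : c.HasLevel false α)
    (X : ℕ → Bool) : c.Holds X ↔ ∀ i, (c.child i).Holds X := by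
  cases c with
  | leaf θ => simp [BorelCode.child]
  | disj c => exact h.elim
  | conj c => rfl

/-- The intersection of the clopen sets in a list of labels, if all of them are labels of leaves. -/
def interLabels (l : List (Clopen ⊕ Bool)) : Option Clopen :=
  l.foldr (fun x o => x.elim (fun θ => o.map θ.inter) fun _ => none) (some [[]])

theorem primrec_interLabels : Primrec interLabels := by
  refine Primrec.list_foldr
    (h := fun _ (p : (Clopen ⊕ Bool) × Option Clopen) =>
      p.1.elim (fun θ => p.2.map θ.inter) fun _ => none) Primrec.id (Primrec.const _) ?_
  have : Primrec fun p : List (Clopen ⊕ Bool) × (Clopen ⊕ Bool) × Option Clopen =>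
      (Sum.casesOn p.2.1 (fun θ => p.2.2.map θ.inter) fun _ => none : Option Clopen) := by
    refine Primrec.sumCasesOn (Primrec.fst.comp Primrec.snd) ?_ (Primrec.const none)
    refine Primrec.option_map (Primrec.snd.comp (Primrec.snd.comp Primrec.fst)) ?_
    exact Clopen.primrec_inter.comp (Primrec.snd.comp Primrec.fst) Primrec.snd
  exact this.of_eq fun ⟨_, x, _⟩ => by cases x <;> rfl

/-- The intersection of finitely many sets with `Π⁰_β` codes. -/
def interPi (l : List BorelCode) : BorelCode :=
  match interLabels (l.map fun c => c.label []) with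
  -- An intersection of leaves has to remain a leaf, because a `conj` never has level 0; this
  -- matters for `Σ⁰_1`.
  | some θ => leaf θ
  -- `n` codes a position in the list and a successor of the code found there; positions past the
  -- end contribute the whole space.
  | none => conj fun n => (l[n.unpair.1]?).elim (leaf [[]]) fun c => c.child n.unpair.2

theorem interLabels_eq_some {l : List BorelCode} {θ : Clopen}
    (h : interLabels (l.map fun c => c.label []) = some θ) (X : ℕ → Bool) :
    θ.Holds X ↔ ∀ c ∈ l, c.Holds X := by
  induction l generalizing θ with
  | nil =>
    obtain rfl : [[]] = θ := by simpa [interLabels] using h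
    simp [Clopen.Holds]
  | cons c l ih =>
    rw [List.forall_mem_cons]
    cases c with
    | leaf θ' =>
      obtain ⟨θ'', h', rfl⟩ : ∃ θ'', interLabels (l.map fun c => c.label []) = some θ'' ∧
          Clopen.inter θ' θ'' = θ := by simpa [interLabels, label] using h
      rw [← ih h']
      exact Clopen.holds_inter _ _ _
    | disj c => simp [interLabels, label] at h
    | conj c => simp [interLabels, label] at h

theorem interLabels_eq_none {l : List BorelCode}
    (h : interLabels (l.map fun c => c.label []) = none) : ∃ c ∈ l, ∀ θ, c ≠ leaf θ := by
  induction l with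
  | nil => simp [interLabels] at h
  | cons c l ih =>
    cases c with
    | leaf θ' =>
      obtain ⟨c, hc, H⟩ := ih (by simpa [interLabels, label] using h)
      exact ⟨c, List.mem_cons_of_mem _ hc, H⟩
    | disj c => exact ⟨_, List.mem_cons_self, by simp⟩
    | conj c => exact ⟨_, List.mem_cons_self, by simp⟩

theorem holds_interPi {l : List BorelCode} {β : Ordinal.{0}}
    (h : ∀ c ∈ l, c.HasLevel false β) (X : ℕ → Bool) :
    (interPi l).Holds X ↔ ∀ c ∈ l, c.Holds X := by
  unfold interPi
  split
  next θ hθ => exact interLabels_eq_some hθ X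
  next =>
    constructor
    · intro H c hc
      obtain ⟨k, hk, rfl⟩ := List.getElem_of_mem hc
      refine (holds_iff_forall_child (h _ hc) X).2 fun i => ?_
      simpa [List.getElem?_eq_getElem hk] using H (Nat.pair k i)
    · intro H n
      rcases hk : l[n.unpair.1]? with _ | c <;> simp only [hk, Option.elim]
      · exact ⟨[], by simp⟩
      · have hc := List.mem_of_getElem? hk
        exact (holds_iff_forall_child (h _ hc) X).1 (H c hc) _

theorem HasLevel.interPi {l : List BorelCode} {β : Ordinal.{0}}
    (h : ∀ c ∈ l, c.HasLevel false β) : (interPi l).HasLevel false β := by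
  unfold BorelCode.interPi
  split
  next => trivial
  next hn =>
    -- Some member of the list is a `conj`, which forces a level below `β`; the padding leaves need
    -- one as well.
    have hβ : 0 < β := by
      obtain ⟨c, hc, H⟩ := interLabels_eq_none hn
      have := h c hc
      cases c with
      | leaf θ => exact (H θ rfl).elim
      | disj c => exact this.elim
      | conj c => obtain ⟨γ, hγ, -⟩ := this 0; exact hγ.pos
    intro n
    rcases hk : l[n.unpair.1]? with _ | c <;> simp only [hk, Option.elim]
    · exact ⟨0, hβ, trivial⟩
    · exact (h c (List.mem_of_getElem? hk)).child hβ _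

/-- The substitution of variables. -/
def subst (g : ℕ → ℕ) : BorelCode → BorelCode
  | leaf θ => leaf (θ.map fun c => c.map fun t => (g t.1, t.2))
  | disj c => disj fun i => (c i).subst g
  | conj c => conj fun i => (c i).subst g

theorem holds_subst (g : ℕ → ℕ) (c : BorelCode) (X : ℕ → Bool) :
    (c.subst g).Holds X ↔ c.Holds (fun n => X (g n)) := by
  induction c with
  | leaf θ =>
    constructor
    · rintro ⟨_, hd, H⟩
      obtain ⟨c, hc, rfl⟩ := List.mem_map.1 hd
      exact ⟨c, hc, fun t ht => H _ (List.mem_map_of_mem ht)⟩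
    · rintro ⟨c, hc, H⟩
      exact ⟨_, List.mem_map_of_mem hc, List.forall_mem_map.2 H⟩
  | disj c ih => simp [subst, Holds, ih]
  | conj c ih => simp [subst, Holds, ih]

theorem HasLevel.subst (g : ℕ → ℕ) {c : BorelCode} {s : Bool} {α : Ordinal.{0}}
    (h : c.HasLevel s α) : (c.subst g).HasLevel s α := by
  induction c generalizing s α with
  | leaf θ => trivial
  | disj c ih =>
    cases s with
    | false => exact h.elim
    | true => exact fun i => let ⟨β, hβ, H⟩ := h i; ⟨β, hβ, ih i H⟩
  | conj c ih =>
    cases s with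
    | true => exact h.elim
    | false => exact fun i => let ⟨β, hβ, H⟩ := h i; ⟨β, hβ, ih i H⟩

theorem label_subst (g : ℕ → ℕ) (c : BorelCode) (s : List ℕ) :
    (c.subst g).label s =
      (c.label s).map (fun θ => θ.map fun c => c.map fun t => (g t.1, t.2)) id := by
  induction c generalizing s with
  | leaf θ => cases s <;> rfl
  | disj c ih => cases s <;> simp [BorelCode.subst, label, ih]
  | conj c ih => cases s <;> simp [BorelCode.subst, label, ih]

theorem measurableSet_holds (c : BorelCode) : MeasurableSet {X | c.Holds X} := by
  induction c with
  | leaf θ =>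
    have : {X | (leaf θ).Holds X} = ⋃ c ∈ {c | c ∈ θ}, ⋂ t ∈ {t | t ∈ c}, {X | X t.1 = t.2} := by
      ext X; simp [Holds]
    rw [this]
    refine MeasurableSet.biUnion (List.finite_toSet θ).countable fun c _ =>
      MeasurableSet.biInter (List.finite_toSet c).countable fun t _ => ?_
    exact (measurable_pi_apply (X := fun _ => Bool) t.1) (measurableSet_singleton t.2)
  | disj c ih =>
    have : {X | (disj c).Holds X} = ⋃ i, {X | (c i).Holds X} := by ext X; simp [Holds]
    rw [this]
    exact MeasurableSet.iUnion ih
  | conj c ih =>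
    have : {X | (conj c).Holds X} = ⋂ i, {X | (c i).Holds X} := by ext X; simp [Holds]
    rw [this]
    exact MeasurableSet.iInter ih

end BorelCode

/-! ### The computation of the label of a union of finite intersections -/

namespace BorelCode

variable {I J : Type}

/-- The code of the union over `n` of the sets `⋂_{(i, m) ∈ z} σ_{i, m}`, where `z = D n` and
`σ_{i, m}` is the `m`-th successor of the root of `σ i`. -/
def unionInter (σ : I → BorelCode) (D : ℕ → Option (List (I × ℕ))) : BorelCode :=
  disj fun n => (D n).elim (leaf []) fun z => interPi (z.map fun p => (σ p.1).child p.2)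

/-- The label of an intersection of successors of roots of trees with labels `L i`. -/
def interPiLabel (L : I → List ℕ → Clopen ⊕ Bool) (z : List (I × ℕ)) (s : List ℕ) :
    Clopen ⊕ Bool :=
  match interLabels (z.map fun p => L p.1 [p.2]) with
  | some θ => Sum.inl θ
  | none => match s.head? with
    | none => Sum.inr false
    | some m => match z[m.unpair.1]? with
      | none => Sum.inl [[]]
      | some p => L p.1 (p.2 :: m.unpair.2 :: s.tail)

/-- Whether the intersection is a leaf is decided by the finitely many labels at depth one, and all
labels below are read off the given trees. So the label is computed from the label functions alone,
as lightface codes require. -/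
theorem label_interPi (σ : I → BorelCode) (z : List (I × ℕ)) (s : List ℕ) :
    (interPi (z.map fun p => (σ p.1).child p.2)).label s =
      interPiLabel (fun i => (σ i).label) z s := by
  have h1 : (z.map fun p => (σ p.1).child p.2).map (fun c => c.label []) =
      z.map fun p => (σ p.1).label [p.2] := by
    rw [List.map_map]
    exact List.map_congr_left fun p _ => (label_cons _ _ _).symm
  unfold interPi interPiLabel
  rw [h1]
  cases interLabels (z.map fun p => (σ p.1).label [p.2]) with
  | some θ => cases s <;> rfl
  | none =>
    cases s with
    | nil => rfl
    | cons m s =>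
      simp only [label, List.getElem?_map, Option.elim, List.head?_cons, List.tail_cons]
      cases z[m.unpair.1]? with
      | none => cases s <;> rfl
      | some p => simp [label_cons]

/-- The label of the union over `n` of finite intersections. -/
def unionInterLabel (L : I → List ℕ → Clopen ⊕ Bool) (D : ℕ → Option (List (I × ℕ)))
    (s : List ℕ) : Clopen ⊕ Bool :=
  match s.head? with
  | none => Sum.inr true
  | some n => match D n with
    | none => Sum.inl []
    | some z => interPiLabel L z s.tail

theorem label_unionInter (σ : I → BorelCode) (D : ℕ → Option (List (I × ℕ))) (s : List ℕ) :
    (unionInter σ D).label s = unionInterLabel (fun i => (σ i).label) D s := by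
  cases s with
  | nil => rfl
  | cons n s =>
    simp only [unionInter, unionInterLabel, label, List.head?_cons, List.tail_cons]
    cases D n with
    | none => cases s <;> rfl
    | some z => exact label_interPi σ z s

variable [Primcodable I] [Primcodable J]

theorem computable_interPiLabel {L : I → List ℕ → Clopen ⊕ Bool}
    (hL : Computable fun p : I × List ℕ => L p.1 p.2) :
    Computable fun x : List (I × ℕ) × List ℕ => interPiLabel L x.1 x.2 := by
  have c1 : Computable fun x : List (I × ℕ) × List ℕ =>
      interLabels (x.1.map fun p => L p.1 [p.2]) := by
    have c : Computable₂ fun (_ : List (I × ℕ) × List ℕ) (p : I × ℕ) => L p.1 [p.2] := by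
      have q : Primrec fun x : (List (I × ℕ) × List ℕ) × (I × ℕ) => (x.2.1, [x.2.2]) :=
        Primrec.pair (Primrec.fst.comp Primrec.snd) (Primrec.list_cons.comp
          (Primrec.snd.comp Primrec.snd) (Primrec.const []))
      exact (hL.comp q.to_comp :)
    have c' : Computable fun x : List (I × ℕ) × List ℕ => x.1.map fun p => L p.1 [p.2] :=
      Computable.list_map Computable.fst c
    exact primrec_interLabels.to_comp.comp c'
  have c2 : Computable fun x : ((List (I × ℕ) × List ℕ) × ℕ) × (I × ℕ) =>
      L x.2.1 (x.2.2 :: x.1.2.unpair.2 :: x.1.1.2.tail) := by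
    have q : Primrec fun x : ((List (I × ℕ) × List ℕ) × ℕ) × (I × ℕ) =>
        (x.2.1, x.2.2 :: x.1.2.unpair.2 :: x.1.1.2.tail) :=
      Primrec.pair (Primrec.fst.comp Primrec.snd) (Primrec.list_cons.comp
        (Primrec.snd.comp Primrec.snd) (Primrec.list_cons.comp
          (Primrec.snd.comp (Primrec.unpair.comp (Primrec.snd.comp Primrec.fst)))
          (Primrec.list_tail.comp (Primrec.snd.comp (Primrec.fst.comp Primrec.fst)))))
    exact (hL.comp q.to_comp :)
  have c3 : Computable fun x : (List (I × ℕ) × List ℕ) × ℕ => x.1.1[x.2.unpair.1]? :=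
    (Primrec.list_getElem?.comp (Primrec.fst.comp Primrec.fst)
      (Primrec.fst.comp (Primrec.unpair.comp Primrec.snd))).to_comp
  have c4 : Computable fun x : (List (I × ℕ) × List ℕ) × ℕ =>
      (match x.1.1[x.2.unpair.1]? with
        | none => Sum.inl [[]]
        | some p => L p.1 (p.2 :: x.2.unpair.2 :: x.1.2.tail) : Clopen ⊕ Bool) := by
    refine (Computable.option_casesOn c3 (Computable.const (Sum.inl [[]] : Clopen ⊕ Bool))
      c2.to₂).of_eq fun x => ?_
    cases x.1.1[x.2.unpair.1]? <;> rfl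
  have c5 : Computable fun x : List (I × ℕ) × List ℕ => x.2.head? :=
    (Primrec.list_head?.comp Primrec.snd).to_comp
  have c6 : Computable fun x : List (I × ℕ) × List ℕ =>
      (match x.2.head? with
        | none => Sum.inr false
        | some m => match x.1[m.unpair.1]? with
          | none => Sum.inl [[]]
          | some p => L p.1 (p.2 :: m.unpair.2 :: x.2.tail) : Clopen ⊕ Bool) := by
    refine (Computable.option_casesOn c5 (Computable.const (Sum.inr false : Clopen ⊕ Bool))
      c4.to₂).of_eq fun x => ?_
    cases x.2.head? <;> rfl
  have c7 : Computable fun x : (List (I × ℕ) × List ℕ) × Clopen =>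
      (Sum.inl x.2 : Clopen ⊕ Bool) := Computable.sumInl.comp Computable.snd
  refine (Computable.option_casesOn c1 c6 c7.to₂).of_eq fun x => ?_
  unfold interPiLabel
  cases interLabels (x.1.map fun p => L p.1 [p.2]) <;> rfl

theorem computable_unionInterLabel {L : I → List ℕ → Clopen ⊕ Bool}
    (hL : Computable fun p : I × List ℕ => L p.1 p.2) {D : J → ℕ → Option (List (I × ℕ))}
    (hD : Computable₂ D) :
    Computable fun x : J × List ℕ => unionInterLabel L (D x.1) x.2 := by
  have c1 : Computable fun x : ((J × List ℕ) × ℕ) × List (I × ℕ) =>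
      interPiLabel L x.2 x.1.1.2.tail := by
    have q : Primrec fun x : ((J × List ℕ) × ℕ) × List (I × ℕ) => (x.2, x.1.1.2.tail) :=
      Primrec.pair Primrec.snd (Primrec.list_tail.comp
        (Primrec.snd.comp (Primrec.fst.comp Primrec.fst)))
    exact ((computable_interPiLabel hL).comp q.to_comp :)
  have c2 : Computable fun x : (J × List ℕ) × ℕ => D x.1.1 x.2 :=
    hD.comp (Primrec.fst.comp Primrec.fst).to_comp Computable.snd
  have c3 : Computable fun x : (J × List ℕ) × ℕ =>
      (match D x.1.1 x.2 with
        | none => Sum.inl []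
        | some z => interPiLabel L z x.1.2.tail : Clopen ⊕ Bool) := by
    refine (Computable.option_casesOn c2 (Computable.const (Sum.inl [] : Clopen ⊕ Bool))
      c1.to₂).of_eq fun x => ?_
    cases D x.1.1 x.2 <;> rfl
  have c4 : Computable fun x : J × List ℕ => x.2.head? :=
    (Primrec.list_head?.comp Primrec.snd).to_comp
  refine (Computable.option_casesOn c4 (Computable.const (Sum.inr true : Clopen ⊕ Bool))
    c3.to₂).of_eq fun x => ?_
  unfold unionInterLabel
  cases x.2.head? <;> rfl

end BorelCode

/-! ### Simultaneous choice of successors of the roots -/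

section Select

variable {I J : Type} [Primcodable I] [Primcodable J]

open Classical in
/-- An enumeration of the lists of pairs whose first components form one of the lists `D j i`. -/
noncomputable def select (D : J → ℕ → Option (List I)) (j : J) (n : ℕ) :
    Option (List (I × ℕ)) :=
  (Encodable.decode (α := ℕ × List (I × ℕ)) n).bind fun q =>
    bif decide (D j q.1 = some (q.2.map Prod.fst)) then some q.2 else none

-- The choices needed for distributivity: to meet finitely many unions, a component number is
-- attached to each index of a list `D j n`, and all ways to do so are enumerated.
omit [Primcodable J] in
theorem exists_select (D : J → ℕ → Option (List I)) (j : J) (z : List (I × ℕ)) :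
    (∃ n, select D j n = some z) ↔ ∃ n, D j n = some (z.map Prod.fst) := by
  constructor
  · rintro ⟨n, hn⟩
    obtain ⟨q, -, hq⟩ := Option.bind_eq_some_iff.1 hn
    by_cases h : D j q.1 = some (q.2.map Prod.fst)
    · obtain rfl : q.2 = z := by simpa [h] using hq
      exact ⟨_, h⟩
    · simp [h] at hq
  · rintro ⟨n, hn⟩
    exact ⟨Encodable.encode (n, z), by simp [select, hn]⟩

theorem computable_select {D : J → ℕ → Option (List I)} (hD : Computable₂ D) :
    Computable₂ (select D) := by
  classical
  have h1 : Computable fun x : (J × ℕ) × (ℕ × List (I × ℕ)) => D x.1.1 x.2.1 :=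
    hD.comp (Primrec.fst.comp Primrec.fst).to_comp (Primrec.fst.comp Primrec.snd).to_comp
  have h2 : Primrec fun x : (J × ℕ) × (ℕ × List (I × ℕ)) => some (x.2.2.map Prod.fst) :=
    Primrec.option_some.comp (Primrec.list_map (Primrec.snd.comp Primrec.snd)
      (Primrec.fst.comp Primrec.snd))
  have h3 : Primrec₂ fun a b : Option (List I) => decide (a = b) :=
    (Primrec.eq (α := Option (List I))).decide
  have h4 : Computable fun x : (J × ℕ) × (ℕ × List (I × ℕ)) =>
      decide (D x.1.1 x.2.1 = some (x.2.2.map Prod.fst)) :=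
    h3.to_comp.comp h1 h2.to_comp
  have h5 : Computable fun x : J × ℕ =>
      Encodable.decode (α := ℕ × List (I × ℕ)) x.2 :=
    Computable.decode.comp Computable.snd
  have h6 : Computable fun x : (J × ℕ) × (ℕ × List (I × ℕ)) => some x.2.2 :=
    (Primrec.option_some.comp (Primrec.snd.comp Primrec.snd)).to_comp
  exact Computable.option_bind h5 (Computable.cond h4 h6 (Computable.const none)).to₂

end Select

/-! ### Uniformly `Σ⁰_α` families of relations -/

/-- The family of relations `Y t i` is `Σ⁰_α` in the points `inp t`, uniformly in `i`. -/
def SigmaFam {T I : Type} [Primcodable I] (E : Face) (α : Ordinal.{0}) (inp : T → ℕ → Bool)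
    (Y : T → I → Prop) : Prop :=
  ∃ σ : I → BorelCode, (∀ i, (σ i).HasLevel true α) ∧
    (E = Face.lightface → Computable fun p : I × List ℕ => (σ p.1).label p.2) ∧
    ∀ t i, Y t i ↔ (σ i).Holds (inp t)

namespace SigmaFam

variable {T I J K : Type} [Primcodable I] [Primcodable J] [Primcodable K] {E : Face}
  {α : Ordinal.{0}} {inp : T → ℕ → Bool}

theorem congr {Y Z : T → I → Prop} (h : SigmaFam E α inp Y) (H : ∀ t i, Z t i ↔ Y t i) :
    SigmaFam E α inp Z := by
  obtain rfl : Z = Y := by funext t i; exact propext (H t i)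
  exact h

theorem reindex {Y : T → I → Prop} (h : SigmaFam E α inp Y) {g : J → I} (hg : Computable g) :
    SigmaFam E α inp fun t j => Y t (g j) := by
  obtain ⟨σ, hl, hc, hσ⟩ := h
  exact ⟨fun j => σ (g j), fun j => hl _,
    fun hE => (hc hE).comp (Computable.pair (hg.comp Computable.fst) Computable.snd),
    fun t j => hσ t _⟩

/-- Used to read the source and the target of a morphism out of the join that codes it; `g` is the
position of a bit in the join. -/
theorem changeInput {T' : Type} {inp' : T' → ℕ → Bool} {Y : T → I → Prop}
    (h : SigmaFam E α inp Y) (r : T' → T) {g : ℕ → ℕ} (hg : Primrec g)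
    (H : ∀ t n, inp (r t) n = inp' t (g n)) : SigmaFam E α inp' fun t i => Y (r t) i := by
  obtain ⟨σ, hl, hc, hσ⟩ := h
  refine ⟨fun i => (σ i).subst g, fun i => (hl i).subst g, fun hE => ?_, fun t i => ?_⟩
  · have h1 : Primrec fun θ : Clopen => θ.map fun c => c.map fun t => (g t.1, t.2) := by
      refine Primrec.list_map Primrec.id (Primrec.list_map Primrec.snd ?_)
      exact Primrec.pair (hg.comp (Primrec.fst.comp Primrec.snd)) (Primrec.snd.comp Primrec.snd)
    have h2 : Primrec fun x : Clopen ⊕ Bool =>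
        x.map (fun θ => θ.map fun c => c.map fun t => (g t.1, t.2)) id := by
      have : Primrec fun x : Clopen ⊕ Bool => (Sum.casesOn x
          (fun θ => Sum.inl (θ.map fun c => c.map fun t => (g t.1, t.2))) fun b => Sum.inr b :
            Clopen ⊕ Bool) :=
        Primrec.sumCasesOn Primrec.id (Primrec.sumInl.comp (h1.comp Primrec.snd))
          (Primrec.sumInr.comp Primrec.snd)
      exact this.of_eq fun x => by cases x <;> rfl
    exact (h2.to_comp.comp (hc hE)).of_eq fun p => (BorelCode.label_subst _ _ _).symm
  · have : inp (r t) = fun n => inp' t (g n) := funext (H t)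
    exact (hσ _ _).trans (this ▸ (BorelCode.holds_subst g (σ i) (inp' t)).symm)

theorem literal (b : Bool) : SigmaFam E α inp fun t n => inp t n = b := by
  refine ⟨fun n => .leaf [[(n, b)]], fun n => trivial, fun _ => ?_, fun t n => ?_⟩
  · have : Primrec fun p : ℕ × List ℕ => (Sum.inl [[(p.1, b)]] : Clopen ⊕ Bool) :=
      Primrec.sumInl.comp (Primrec.list_cons.comp (Primrec.list_cons.comp
        (Primrec.pair Primrec.fst (Primrec.const b)) (Primrec.const [])) (Primrec.const []))
    exact this.to_comp
  · refine ⟨fun h => ⟨_, List.mem_singleton_self _, ?_⟩, ?_⟩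
    · rintro _ ht
      obtain rfl := List.mem_singleton.1 ht
      exact h
    · rintro ⟨_, hc, H⟩
      obtain rfl := List.mem_singleton.1 hc
      exact H _ (List.mem_singleton_self _)

/-- A `Σ⁰_α` code is the union of the successors of its root, which have `Π` levels below `α`. By
distributivity a finite intersection of such unions is a union, over all choices of successors, of
finite intersections of `Π` codes. Finitely many levels below `α` have a maximum below `α`, so limit
levels cause no trouble. The closure properties under conjunction, disjunction and quantification
all reduce to this one. -/
theorem unionInter (hα : 1 ≤ α) {Y : T → I → Prop} (h : SigmaFam E α inp Y)
    {D : J → ℕ → Option (List I)} (hD : Computable₂ D) :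
    SigmaFam E α inp fun t j => ∃ n L, D j n = some L ∧ ∀ i ∈ L, Y t i := by
  obtain ⟨σ, hl, hc, hσ⟩ := h
  have h0 : 0 < α := Order.one_le_iff_pos.1 hα
  have hlev : ∀ z : List (I × ℕ), ∃ β < α,
      ∀ c ∈ z.map fun p => (σ p.1).child p.2, c.HasLevel false β := by
    intro z
    induction z with
    | nil => exact ⟨0, h0, by simp⟩
    | cons p z ih =>
      obtain ⟨β, hβ, H⟩ := ih
      obtain ⟨γ, hγ, H'⟩ := (hl p.1).child h0 p.2
      refine ⟨max β γ, max_lt hβ hγ, List.forall_mem_cons.2 ⟨H'.mono (le_max_right _ _), ?_⟩⟩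
      exact fun c hc => (H c hc).mono (le_max_left _ _)
  refine ⟨fun j => .unionInter σ (select D j), fun j n => ?_, fun hE => ?_, fun t j => ?_⟩
  · rcases h : select D j n with _ | z <;> simp only [h, Option.elim]
    · exact ⟨0, h0, trivial⟩
    · obtain ⟨β, hβ, H⟩ := hlev z
      exact ⟨β, hβ, BorelCode.HasLevel.interPi H⟩
  · exact (BorelCode.computable_unionInterLabel (hc hE) (computable_select hD)).of_eq
      fun p => (BorelCode.label_unionInter σ _ p.2).symm
  · have h1 : (BorelCode.unionInter σ (select D j)).Holds (inp t) ↔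
        ∃ n z, select D j n = some z ∧ ∀ p ∈ z, ((σ p.1).child p.2).Holds (inp t) := by
      refine exists_congr fun n => ?_
      beta_reduce
      rcases select D j n with _ | z
      · exact iff_of_false (by simp [BorelCode.Holds]) (by simp)
      · obtain ⟨β, -, H⟩ := hlev z
        have := BorelCode.holds_interPi H (inp t)
        rw [List.forall_mem_map] at this
        simpa only [Option.some.injEq, exists_eq_left', Option.elim_some] using this
    rw [h1]
    constructor
    · rintro ⟨n, L, hn, H⟩
      -- `v i` is the number of a successor that witnesses membership in the set with index `i`.
      choose! v hv using fun i hi =>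
        (BorelCode.holds_iff_exists_child (hl i) (inp t)).1 ((hσ t i).1 (H i hi))
      obtain ⟨m, hm⟩ := (exists_select D j (L.map fun i => (i, v i))).2
        ⟨n, by simpa [Function.comp_def]⟩
      refine ⟨m, _, hm, fun p hp => ?_⟩
      obtain ⟨i, hi, rfl⟩ := List.mem_map.1 hp
      exact hv i hi
    · rintro ⟨n, z, hn, H⟩
      obtain ⟨m, hm⟩ := (exists_select D j z).1 ⟨n, hn⟩
      refine ⟨m, _, hm, fun i hi => ?_⟩
      obtain ⟨p, hp, rfl⟩ := List.mem_map.1 hi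
      exact (hσ t _).2 ((BorelCode.holds_iff_exists_child (hl _) (inp t)).2 ⟨_, H p hp⟩)

/-! #### Closure properties -/

/-- Joins two families into one, so that conjunction and disjunction become special cases of
quantification over a list and over an index. -/
theorem bool {Y : T → I × Bool → Prop} (h1 : SigmaFam E α inp fun t i => Y t (i, true))
    (h2 : SigmaFam E α inp fun t i => Y t (i, false)) : SigmaFam E α inp Y := by
  obtain ⟨σ, hl, hc, hσ⟩ := h1
  obtain ⟨σ', hl', hc', hσ'⟩ := h2
  refine ⟨fun p => bif p.2 then σ p.1 else σ' p.1, fun ⟨i, b⟩ => ?_, fun hE => ?_,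
    fun t ⟨i, b⟩ => ?_⟩
  · cases b
    exacts [hl' i, hl i]
  · have c : Computable fun p : (I × Bool) × List ℕ => (p.1.1, p.2) :=
      Computable.pair (Computable.fst.comp Computable.fst) Computable.snd
    refine (Computable.cond (Computable.snd.comp Computable.fst) ((hc hE).comp c)
      ((hc' hE).comp c)).of_eq fun ⟨⟨i, b⟩, s⟩ => ?_
    cases b <;> rfl
  · cases b
    exacts [hσ' t i, hσ t i]

variable (hα : 1 ≤ α)
include hα

/-- A condition on the index alone is a union of empty intersections where it holds and an empty
union where it fails. -/
theorem decidable {p : I → Prop} [DecidablePred p] (hp : Computable fun i => decide (p i)) :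
    SigmaFam E α inp fun _ => p := by
  have h0 : SigmaFam E α inp fun t n => inp t n = true := literal true
  refine (h0.unionInter hα (J := I) (D := fun i _ => bif decide (p i) then some [] else none)
    ?_).congr fun t i => ?_
  · exact Computable.cond (hp.comp Computable.fst) (Computable.const _) (Computable.const _)
  · by_cases h : p i <;> simp [h]

theorem forall_mem {Y : T → I → Prop} (h : SigmaFam E α inp Y) {D : J → List I}
    (hD : Computable D) : SigmaFam E α inp fun t j => ∀ i ∈ D j, Y t i := by
  refine (h.unionInter hα (D := fun j _ => some (D j)) ?_).congr fun t j => ?_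
  · exact Computable.option_some.comp (hD.comp Computable.fst)
  · simp

theorem exists_snd {Y : T → J × I → Prop} (h : SigmaFam E α inp Y) :
    SigmaFam E α inp fun t j => ∃ i, Y t (j, i) := by
  refine (h.unionInter hα (J := J)
    (D := fun j n => (Encodable.decode (α := I) n).map fun i => [(j, i)]) ?_).congr fun t j => ?_
  · refine Computable.option_map (Computable.decode.comp Computable.snd) ?_
    exact Computable.list_cons.comp (Computable.pair (Computable.fst.comp Computable.fst)
      Computable.snd) (Computable.const [])
  · constructor
    · rintro ⟨i, hi⟩
      exact ⟨Encodable.encode i, [(j, i)], by simp, by simpa using hi⟩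
    · rintro ⟨n, L, hn, H⟩
      obtain ⟨i, -, rfl⟩ := Option.map_eq_some_iff.1 hn
      exact ⟨i, H _ List.mem_cons_self⟩

theorem and {Y Z : T → I → Prop} (h1 : SigmaFam E α inp Y) (h2 : SigmaFam E α inp Z) :
    SigmaFam E α inp fun t i => Y t i ∧ Z t i := by
  have h : SigmaFam E α inp fun t (p : I × Bool) => bif p.2 then Y t p.1 else Z t p.1 :=
    bool h1 h2
  refine (h.forall_mem hα (D := fun i => [(i, true), (i, false)]) ?_).congr fun t i => ?_
  · exact Computable.list_cons.comp (Computable.pair Computable.id (Computable.const true))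
      (Computable.list_cons.comp (Computable.pair Computable.id (Computable.const false))
        (Computable.const []))
  · simp

theorem or {Y Z : T → I → Prop} (h1 : SigmaFam E α inp Y) (h2 : SigmaFam E α inp Z) :
    SigmaFam E α inp fun t i => Y t i ∨ Z t i := by
  have h : SigmaFam E α inp fun t (p : I × Bool) => bif p.2 then Y t p.1 else Z t p.1 :=
    bool h1 h2
  exact (h.exists_snd hα).congr fun t i => by simp [or_comm]

end SigmaFam

/-- The family of relations `Y t i` is `Δ⁰_α` in the points `inp t`, uniformly in `i`. -/
def DeltaFam {T I : Type} [Primcodable I] (E : Face) (α : Ordinal.{0}) (inp : T → ℕ → Bool)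
    (Y : T → I → Prop) : Prop :=
  SigmaFam E α inp Y ∧ SigmaFam E α inp fun t i => ¬ Y t i

theorem BorelCode.computable_label_compl {I : Type} [Primcodable I] {σ : I → BorelCode}
    (h : Computable fun p : I × List ℕ => (σ p.1).label p.2) :
    Computable fun p : I × List ℕ => (σ p.1).compl.label p.2 := by
  have : Primrec fun x : Clopen ⊕ Bool => (Sum.casesOn x
      (fun θ => Sum.inl (Clopen.compl θ)) fun b => Sum.inr (!b) : Clopen ⊕ Bool) :=
    Primrec.sumCasesOn Primrec.id (Primrec.sumInl.comp (Clopen.primrec_compl.comp Primrec.snd))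
      (Primrec.sumInr.comp (Primrec.not.comp Primrec.snd))
  refine (this.to_comp.comp h).of_eq fun p => ?_
  rw [BorelCode.label_compl]
  cases (σ p.1).label p.2 <;> rfl

/-- The complement of a `Σ` code for the negation serves as the `Π` code. -/
theorem DeltaFam.isDeltaOp {T : Type} {E : Face} {α : Ordinal.{0}} {inp out : T → ℕ → Bool}
    (h : DeltaFam E α inp fun t n => out t n = true) : IsDeltaOp E α inp out := by
  obtain ⟨⟨σ, hl, hc, hσ⟩, ⟨σ', hl', hc', hσ'⟩⟩ := h
  refine ⟨σ, fun n => (σ' n).compl, fun n => ⟨hl n, (hl' n).compl⟩,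
    fun hE => ⟨hc hE, BorelCode.computable_label_compl (hc' hE)⟩, fun t n => ⟨hσ t n, ?_⟩⟩
  rw [BorelCode.holds_compl, ← hσ', not_not]

/-- Totality makes the complement `Σ⁰_α` too: a value differs from `j` exactly when it equals some
`j' ≠ j`. -/
theorem DeltaFam.of_graph {T I J : Type} [Primcodable I] [Primcodable J] {E : Face}
    {α : Ordinal.{0}} (hα : 1 ≤ α) {inp : T → ℕ → Bool} {f : T → I → J}
    (h : SigmaFam E α inp fun t (p : I × J) => f t p.1 = p.2) :
    DeltaFam E α inp fun t (p : I × J) => f t p.1 = p.2 := by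
  classical
  refine ⟨h, ?_⟩
  have h1 : SigmaFam E α inp fun t (q : (I × J) × J) => f t q.1.1 = q.2 :=
    h.reindex (g := fun q : (I × J) × J => (q.1.1, q.2))
      (Computable.pair (Computable.fst.comp Computable.fst) Computable.snd)
  have h2 : Primrec fun q : (I × J) × J => decide (¬ q.1.2 = q.2) :=
    ((Primrec.eq (α := J)).comp (Primrec.snd.comp Primrec.fst) Primrec.snd).not.decide
  refine ((h1.and hα (SigmaFam.decidable hα h2.to_comp)).exists_snd hα).congr fun t p => ?_
  constructor
  · exact fun H => ⟨f t p.1, rfl, fun e => H e.symm⟩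
  · rintro ⟨j, h, H⟩ e
    exact H (e.symm.trans h)

/-- The `Σ` codes alone define a total operator whose bits are Borel; its values off the given
inputs are immaterial. -/
theorem IsDeltaOp.isBorelOp {T : Type} {E : Face} {α : Ordinal.{0}} {inp out : T → ℕ → Bool}
    (h : IsDeltaOp E α inp out) : IsBorelOp inp out := by
  classical
  obtain ⟨σ, π, -, -, H⟩ := h
  refine ⟨fun X n => decide ((σ n).Holds X), measurable_pi_lambda _ fun n => ?_, fun t => ?_⟩
  · refine measurable_to_bool ?_
    convert (σ n).measurableSet_holds using 1
    ext X
    simp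
  · funext n
    rw [Bool.eq_iff_iff, decide_eq_true_iff]
    exact (H t n).1.symm

/-! ### Formulas as Borel codes -/

theorem primrec_ofNat_list : Primrec (Denumerable.ofNat (List ℕ)) :=
  (Primrec.option_getD.comp Primrec.decode (Primrec.const [])).of_eq fun n => by
    rw [Denumerable.decode_eq_ofNat]; rfl

theorem primrec_ofNat_list_prod : Primrec (Denumerable.ofNat (List ℕ × ℕ)) :=
  (Primrec.option_getD.comp Primrec.decode (Primrec.const ([], 0))).of_eq fun n => by
    rw [Denumerable.decode_eq_ofNat]; rfl

theorem Str.code_encode {a : ℕ → ℕ} (M : Str a) (i : ℕ) (w : List ℕ) :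
    M.code (Encodable.encode (i, w)) = true ↔ w ∈ M.rel i := by
  simp only [Str.code, Denumerable.ofNat_encode, decide_eq_true_eq]

/-- The translation of a literal, at given values of the variables. -/
def Lit.toClause (l : List ℕ) (t : Lit) : List (ℕ × Bool) :=
  if ∀ v ∈ t.2, v < l.length then
    match t.1.2 with
    | some i => [(Encodable.encode (i, t.2.map fun v => l.getD v 0), t.1.1)]
    | none =>
      -- Equality is decided during the translation, as the values are known; comparing with twice
      -- the head tests for the form `[x, x]`. A clause with two contradictory literals denotes the
      -- empty set, also for variables without a value.
      if decide ((t.2.map fun v => l.getD v 0) =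
          [(t.2.map fun v => l.getD v 0).headI, (t.2.map fun v => l.getD v 0).headI]) = t.1.1
      then [] else [(0, true), (0, false)]
  else [(0, true), (0, false)]

/-- Replaces the evaluation relation by a bound check and a total lookup, which are primitive
recursive; under the bound the default 0 is never read. -/
theorem forall₂_getElem?_iff (l v w : List ℕ) :
    List.Forall₂ (fun v x => l[v]? = some x) v w ↔
      (∀ i ∈ v, i < l.length) ∧ w = v.map fun i => l.getD i 0 := by
  induction v generalizing w with
  | nil => cases w <;> simp
  | cons i v ih =>
    cases w with
    | nil => simp
    | cons x w =>
      rw [List.forall₂_cons, ih, List.forall_mem_cons, List.map_cons, List.cons.injEq,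
        List.getElem?_eq_some_iff]
      constructor
      · rintro ⟨⟨h, rfl⟩, h', rfl⟩
        exact ⟨⟨h, h'⟩, by simp [h], rfl⟩
      · rintro ⟨⟨h, h'⟩, rfl, rfl⟩
        exact ⟨⟨h, by simp [h]⟩, h', rfl⟩

theorem atomHolds_none_iff {a : ℕ → ℕ} (M : Str a) (w : List ℕ) :
    atomHolds M none w ↔ w = [w.headI, w.headI] :=
  ⟨by rintro ⟨x, rfl⟩; rfl, fun h => ⟨_, h⟩⟩

theorem Lit.holds_iff {a : ℕ → ℕ} (M : Str a) (l : List ℕ) (t : Lit) :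
    Lit.Holds M t l ↔ ∀ p ∈ t.toClause l, M.code p.1 = p.2 := by
  have hfalse : ¬ ∀ p ∈ [(0, true), (0, false)], M.code p.1 = p.2 := by
    intro H
    have h1 := H (0, true) (by simp)
    have h2 := H (0, false) (by simp)
    exact Bool.noConfusion (h1.symm.trans h2)
  obtain ⟨⟨s, o⟩, v⟩ := t
  have hl : Lit.Holds M ((s, o), v) l ↔
      (∀ i ∈ v, i < l.length) ∧ (s = true ↔ atomHolds M o (v.map fun i => l.getD i 0)) := by
    simp only [Lit.Holds, forall₂_getElem?_iff]
    constructor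
    · rintro ⟨_, ⟨h, rfl⟩, h'⟩
      exact ⟨h, h'⟩
    · rintro ⟨h, h'⟩
      exact ⟨_, ⟨h, rfl⟩, h'⟩
  rw [hl]
  by_cases h : ∀ i ∈ v, i < l.length
  · rw [Lit.toClause, if_pos (by exact h), and_iff_right h]
    cases o with
    | some i =>
      dsimp only
      rw [List.forall_mem_singleton]
      refine Iff.trans ?_ (Bool.eq_iff_iff (b := s)).symm
      rw [M.code_encode]
      exact iff_comm
    | none =>
      rw [atomHolds_none_iff]
      dsimp only
      split
      next h => simp [← h]
      next h =>
        refine iff_of_false (fun H => h ?_) hfalse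
        rw [Bool.eq_iff_iff, decide_eq_true_iff]
        exact H.symm
  · rw [Lit.toClause, if_neg (by exact h)]
    exact iff_of_false (fun H => h H.1) hfalse

theorem Lit.primrec_toClause : Primrec₂ Lit.toClause := by
  have pw : Primrec fun p : List ℕ × Lit => p.2.2.map fun v => p.1.getD v 0 :=
    Primrec.list_map (Primrec.snd.comp Primrec.snd)
      ((Primrec.list_getD 0).comp (Primrec.fst.comp Primrec.fst) Primrec.snd)
  have pb : PrimrecPred fun p : List ℕ × Lit => ∀ v ∈ p.2.2, v < p.1.length := by
    have h : PrimrecRel fun (L : List ℕ) (n : ℕ) => ∀ v ∈ L, v < n :=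
      PrimrecRel.forall_mem_list Primrec.nat_lt
    exact h.comp (Primrec.snd.comp Primrec.snd) (Primrec.list_length.comp Primrec.fst)
  have ph : Primrec fun p : List ℕ × Lit => (p.2.2.map fun v => p.1.getD v 0).headI :=
    Primrec.list_headI.comp pw
  have pe : PrimrecPred fun p : List ℕ × Lit => decide ((p.2.2.map fun v => p.1.getD v 0) =
      [(p.2.2.map fun v => p.1.getD v 0).headI, (p.2.2.map fun v => p.1.getD v 0).headI]) =
        p.2.1.1 := by
    have h : PrimrecPred fun p : List ℕ × Lit => (p.2.2.map fun v => p.1.getD v 0) =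
      [(p.2.2.map fun v => p.1.getD v 0).headI, (p.2.2.map fun v => p.1.getD v 0).headI] :=
      Primrec.eq.comp pw (Primrec.list_cons.comp ph (Primrec.list_cons.comp ph
        (Primrec.const [])))
    exact Primrec.eq.comp h.decide (Primrec.fst.comp (Primrec.fst.comp Primrec.snd))
  have ps : Primrec₂ fun (p : List ℕ × Lit) (i : ℕ) =>
      [(Encodable.encode (i, p.2.2.map fun v => p.1.getD v 0), p.2.1.1)] :=
    Primrec.list_cons.comp (Primrec.pair (Primrec.encode.comp (Primrec.pair Primrec.snd
      (pw.comp Primrec.fst))) (Primrec.fst.comp (Primrec.fst.comp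
        (Primrec.snd.comp Primrec.fst)))) (Primrec.const [])
  have pn : Primrec fun p : List ℕ × Lit =>
      if decide ((p.2.2.map fun v => p.1.getD v 0) =
        [(p.2.2.map fun v => p.1.getD v 0).headI, (p.2.2.map fun v => p.1.getD v 0).headI]) =
          p.2.1.1 then [] else [(0, true), (0, false)] :=
    Primrec.ite pe (Primrec.const _) (Primrec.const _)
  refine (Primrec.ite pb (Primrec.option_casesOn (Primrec.snd.comp (Primrec.fst.comp
    Primrec.snd)) pn ps) (Primrec.const [(0, true), (0, false)])).of_eq fun ⟨l, ⟨s, o⟩, v⟩ => ?_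
  cases o <;> rfl

/-- The translation of a finitary quantifier-free formula, at given values of the variables. -/
def QFree.toClopen (l : List ℕ) (θ : QFree) : Clopen :=
  θ.map fun c => c.flatMap fun t => t.toClause l

theorem QFree.holds_iff {a : ℕ → ℕ} (M : Str a) (l : List ℕ) (θ : QFree) :
    θ.Holds M l ↔ (θ.toClopen l).Holds M.code := by
  have key : ∀ c : List Lit, (∀ t ∈ c, Lit.Holds M t l) ↔
      ∀ p ∈ c.flatMap fun t => t.toClause l, M.code p.1 = p.2 := by
    intro c
    simp only [Lit.holds_iff, List.mem_flatMap]
    exact ⟨fun H p ⟨t, ht, hp⟩ => H t ht p hp, fun H t ht p hp => H p ⟨t, ht, hp⟩⟩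
  simp only [QFree.Holds, Clopen.Holds, QFree.toClopen, List.mem_map, exists_exists_and_eq_and,
    key]

theorem QFree.primrec_toClopen : Primrec₂ QFree.toClopen := by
  have h : Primrec₂ fun (p : List ℕ × QFree) (c : List Lit) =>
      c.flatMap fun t => t.toClause p.1 :=
    Primrec.list_flatMap Primrec.snd (Lit.primrec_toClause.comp
      (Primrec.fst.comp (Primrec.fst.comp Primrec.fst)) Primrec.snd)
  exact Primrec.list_map Primrec.snd h

namespace Fml

/-- The set of structures in which a formula is true of a given tuple. -/
def toBorel : Fml → List ℕ → BorelCode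
  | leaf θ, l => .leaf (θ.toClopen l)
  | disj ψ, l => .disj fun n =>
      (ψ (Denumerable.ofNat (List ℕ × ℕ) n).1.length (Denumerable.ofNat (List ℕ × ℕ) n).2).toBorel
        (l ++ (Denumerable.ofNat (List ℕ × ℕ) n).1)
  | conj ψ, l => .conj fun n =>
      (ψ (Denumerable.ofNat (List ℕ × ℕ) n).1.length (Denumerable.ofNat (List ℕ × ℕ) n).2).toBorel
        (l ++ (Denumerable.ofNat (List ℕ × ℕ) n).1)

theorem holds_toBorel {a : ℕ → ℕ} (M : Str a) (φ : Fml) (l : List ℕ) :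
    (φ.toBorel l).Holds M.code ↔ φ.Realize M l := by
  induction φ generalizing l with
  | leaf θ => exact (QFree.holds_iff M l θ).symm
  | disj ψ ih =>
    simp only [toBorel, BorelCode.Holds, Realize, ih]
    constructor
    · rintro ⟨n, h⟩
      exact ⟨_, _, h⟩
    · rintro ⟨u, j, h⟩
      exact ⟨Encodable.encode (u, j), by simpa using h⟩
  | conj ψ ih =>
    simp only [toBorel, BorelCode.Holds, Realize, ih]
    exact ⟨fun h u j => by simpa using h (Encodable.encode (u, j)), fun h n => h _ _⟩

/-- A quantifier block and the disjunction or conjunction next to it turn into one countable union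
or intersection, indexed by codes of pairs (new values, index), so the level is kept. -/
theorem HasLevel.toBorel {φ : Fml} {s : Bool} {α : Ordinal.{0}} (h : φ.HasLevel s α)
    (l : List ℕ) : (φ.toBorel l).HasLevel s α := by
  induction φ generalizing s α l with
  | leaf θ => trivial
  | disj ψ ih =>
    cases s with
    | false => exact h.elim
    | true => exact fun n => let ⟨β, hβ, H⟩ := h _ _; ⟨β, hβ, ih _ _ H _⟩
  | conj ψ ih =>
    cases s with
    | true => exact h.elim
    | false => exact fun n => let ⟨β, hβ, H⟩ := h _ _; ⟨β, hβ, ih _ _ H _⟩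

/-- One step from the root of the code of a formula: the path in the tree of the formula with
labels `L`, and the values of the variables. The path stops at leaves. -/
def pathStep (L : List (ℕ × ℕ) → QFree ⊕ Bool) (st : List (ℕ × ℕ) × List ℕ) (n : ℕ) :
    List (ℕ × ℕ) × List ℕ :=
  bif (L st.1).isLeft then st else
    (st.1 ++ [((Denumerable.ofNat (List ℕ × ℕ) n).1.length, (Denumerable.ofNat (List ℕ × ℕ) n).2)],
      st.2 ++ (Denumerable.ofNat (List ℕ × ℕ) n).1)

/-- The label of the code of a formula. -/
def borelLabel (L : List (ℕ × ℕ) → QFree ⊕ Bool) (st : List (ℕ × ℕ) × List ℕ) (s : List ℕ) :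
    Clopen ⊕ Bool :=
  (L (s.foldl (pathStep L) st).1).map (QFree.toClopen (s.foldl (pathStep L) st).2) id

/-- A path in the Borel code determines a path in the formula tree together with the values of the
variables: each number decodes to a tuple, of which the formula tree sees only the length, and an
index. For the induction, `φ` is the subtree at `p` of the tree labelled by `L`. At a leaf the walk
must stop, since further numbers must not add values. -/
theorem label_toBorel (φ : Fml) (L : List (ℕ × ℕ) → QFree ⊕ Bool) (p : List (ℕ × ℕ))
    (l s : List ℕ) (h : ∀ r, L (p ++ r) = φ.label r) :
    (φ.toBorel l).label s = borelLabel L (p, l) s := by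
  induction φ generalizing p l s with
  | leaf θ =>
    have h0 : L p = Sum.inl θ := by simpa [label] using h []
    have hs : ∀ n, pathStep L (p, l) n = (p, l) := fun n => by simp [pathStep, h0]
    have hf : s.foldl (pathStep L) (p, l) = (p, l) := by
      induction s with
      | nil => rfl
      | cons n s ih => rw [List.foldl_cons, hs, ih]
    simp only [borelLabel, hf, h0]
    cases s <;> rfl
  | disj ψ ih =>
    have h0 : L p = Sum.inr true := by simpa [label] using h []
    cases s with
    | nil => simp [borelLabel, h0, toBorel, BorelCode.label]
    | cons n s =>
      have hs : pathStep L (p, l) n = (p ++ [((Denumerable.ofNat (List ℕ × ℕ) n).1.length,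
          (Denumerable.ofNat (List ℕ × ℕ) n).2)],
            l ++ (Denumerable.ofNat (List ℕ × ℕ) n).1) := by
        simp only [pathStep, h0, Sum.isLeft_inr, cond_false]
      rw [borelLabel, List.foldl_cons, hs]
      exact ih _ _ _ _ _ fun r => by rw [List.append_assoc]; exact h _
  | conj ψ ih =>
    have h0 : L p = Sum.inr false := by simpa [label] using h []
    cases s with
    | nil => simp [borelLabel, h0, toBorel, BorelCode.label]
    | cons n s =>
      have hs : pathStep L (p, l) n = (p ++ [((Denumerable.ofNat (List ℕ × ℕ) n).1.length,
          (Denumerable.ofNat (List ℕ × ℕ) n).2)],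
            l ++ (Denumerable.ofNat (List ℕ × ℕ) n).1) := by
        simp only [pathStep, h0, Sum.isLeft_inr, cond_false]
      rw [borelLabel, List.foldl_cons, hs]
      exact ih _ _ _ _ _ fun r => by rw [List.append_assoc]; exact h _

theorem computable_borelLabel {I : Type} [Primcodable I] {L : I → List (ℕ × ℕ) → QFree ⊕ Bool}
    (hL : Computable fun p : I × List (ℕ × ℕ) => L p.1 p.2) {l : I → List ℕ} (hl : Computable l) :
    Computable fun p : I × List ℕ => borelLabel (L p.1) ([], l p.1) p.2 := by
  have cp : Computable fun x : (I × List ℕ) × ((List (ℕ × ℕ) × List ℕ) × ℕ) =>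
      (L x.1.1 x.2.1.1).isLeft := by
    have q : Primrec fun x : (I × List ℕ) × ((List (ℕ × ℕ) × List ℕ) × ℕ) =>
        (x.1.1, x.2.1.1) :=
      Primrec.pair (Primrec.fst.comp Primrec.fst)
        (Primrec.fst.comp (Primrec.fst.comp Primrec.snd))
    have q' : Primrec fun x : QFree ⊕ Bool => x.isLeft := by
      have : Primrec fun x : QFree ⊕ Bool =>
          (Sum.casesOn x (fun _ => true) fun _ => false : Bool) :=
        Primrec.sumCasesOn Primrec.id (Primrec.const true) (Primrec.const false)
      exact this.of_eq fun x => by cases x <;> rfl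
    exact q'.to_comp.comp (hL.comp q.to_comp :)
  have cs : Computable₂ fun (x : I × List ℕ) (y : (List (ℕ × ℕ) × List ℕ) × ℕ) =>
      pathStep (L x.1) y.1 y.2 := by
    have q1 : Primrec fun x : (I × List ℕ) × ((List (ℕ × ℕ) × List ℕ) × ℕ) =>
        Denumerable.ofNat (List ℕ × ℕ) x.2.2 :=
      primrec_ofNat_list_prod.comp (Primrec.snd.comp Primrec.snd)
    have q2 : Primrec fun x : (I × List ℕ) × ((List (ℕ × ℕ) × List ℕ) × ℕ) =>
        (x.2.1.1 ++ [((Denumerable.ofNat (List ℕ × ℕ) x.2.2).1.length,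
          (Denumerable.ofNat (List ℕ × ℕ) x.2.2).2)],
          x.2.1.2 ++ (Denumerable.ofNat (List ℕ × ℕ) x.2.2).1) :=
      Primrec.pair
        (Primrec.list_append.comp (Primrec.fst.comp (Primrec.fst.comp Primrec.snd))
          (Primrec.list_cons.comp (Primrec.pair (Primrec.list_length.comp (Primrec.fst.comp q1))
            (Primrec.snd.comp q1)) (Primrec.const [])))
        (Primrec.list_append.comp (Primrec.snd.comp (Primrec.fst.comp Primrec.snd))
          (Primrec.fst.comp q1))
    exact Computable.cond cp (Primrec.fst.comp Primrec.snd).to_comp q2.to_comp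
  have cg : Computable fun p : I × List ℕ => (([] : List (ℕ × ℕ)), l p.1) :=
    Computable.pair (Computable.const []) (hl.comp Computable.fst)
  have cf : Computable fun p : I × List ℕ => p.2.foldl (pathStep (L p.1)) ([], l p.1) :=
    Computable.list_foldl (f := fun p : I × List ℕ => p.2)
      (g := fun p : I × List ℕ => (([] : List (ℕ × ℕ)), l p.1))
      (h := fun x y => pathStep (L x.1) y.1 y.2) Computable.snd cg cs
  have cl : Computable fun p : I × List ℕ =>
      L p.1 (p.2.foldl (pathStep (L p.1)) ([], l p.1)).1 :=
    (hL.comp (Computable.pair Computable.fst (Computable.fst.comp cf)) :)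
  have ct : Primrec₂ fun (l : List ℕ) (x : QFree ⊕ Bool) =>
      (x.map (QFree.toClopen l) id : Clopen ⊕ Bool) := by
    have : Primrec fun p : List ℕ × (QFree ⊕ Bool) => (Sum.casesOn p.2
        (fun θ => Sum.inl (θ.toClopen p.1)) fun b => Sum.inr b : Clopen ⊕ Bool) :=
      Primrec.sumCasesOn Primrec.snd (Primrec.sumInl.comp (QFree.primrec_toClopen.comp
        (Primrec.fst.comp Primrec.fst) Primrec.snd)) (Primrec.sumInr.comp Primrec.snd)
    exact this.of_eq fun ⟨l, x⟩ => by cases x <;> rfl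
  exact ct.to_comp.comp (Computable.snd.comp cf) cl

end Fml

/-! ### Definable relations in the copies of a structure -/

/-- The isomorphism of a copy with the structure. -/
noncomputable def IsoClass.iso {a : ℕ → ℕ} {A : Str a} (M : IsoClass A) : Isom M.str A :=
  M.isom.some

/-- The relation in a copy of `B` that corresponds to a relation in `B`. -/
def IsoClass.pull {b : ℕ → ℕ} {B : Str b} (M : IsoClass B) (S : Set (List (List ℕ))) :
    Set (List (List ℕ)) :=
  {K | K.map (List.map M.iso.toEquiv) ∈ S}

theorem computable_label_toBorel {φ : ℕ → List ℕ → Fml}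
    (hφ : Computable fun p : (ℕ × List ℕ) × List (ℕ × ℕ) => (φ p.1.1 p.1.2).label p.2) :
    Computable fun p : (ℕ × List (List ℕ)) × List ℕ =>
      ((φ p.1.1 (p.1.2.map List.length)).toBorel p.1.2.flatten).label p.2 := by
  have q : Primrec fun x : (ℕ × List (List ℕ)) × List (ℕ × ℕ) =>
      ((x.1.1, x.1.2.map List.length), x.2) :=
    Primrec.pair (Primrec.pair (Primrec.fst.comp Primrec.fst)
      (Primrec.list_map (Primrec.snd.comp Primrec.fst) (Primrec.list_length.comp Primrec.snd)))
      Primrec.snd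
  have c1 : Computable fun x : (ℕ × List (List ℕ)) × List (ℕ × ℕ) =>
      (φ x.1.1 (x.1.2.map List.length)).label x.2 := (hφ.comp q.to_comp :)
  have c2 : Computable fun p : ℕ × List (List ℕ) => p.2.flatten :=
    (Primrec.list_flatten.comp Primrec.snd).to_comp
  have c := Fml.computable_borelLabel
    (L := fun p : ℕ × List (List ℕ) => (φ p.1 (p.2.map List.length)).label) c1 c2
  refine c.of_eq fun p => ?_
  exact (Fml.label_toBorel _ _ [] _ _ fun r => rfl).symm

theorem IsoClass.realize_iff_holds {b : ℕ → ℕ} {B : Str b} (M : IsoClass B) (φ : List ℕ → Fml)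
    (L : List (List ℕ)) :
    (φ ((L.map (List.map M.iso.toEquiv)).map List.length)).Realize B
        (L.map (List.map M.iso.toEquiv)).flatten ↔
      ((φ (L.map List.length)).toBorel L.flatten).Holds M.str.code := by
  have h1 : (L.map (List.map M.iso.toEquiv)).map List.length = L.map List.length := by
    rw [List.map_map]; congr 1; funext l; simp
  rw [Fml.holds_toBorel, Fml.realize_map M.iso, h1, List.map_flatten]

/-- Truth is invariant under isomorphism, so the formulas that work in `B` work in every copy,
whatever isomorphism is used. The `Σ` formulas yield the relation and the complements of the `Π`
formulas its negation. -/
theorem DeltaDefinable.deltaFam {b : ℕ → ℕ} {B : Str b} {E : Face} {α : Ordinal.{0}}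
    {S : ℕ → Set (List (List ℕ))} (h : DeltaDefinable E α B S) :
    DeltaFam E α (fun M : IsoClass B => M.str.code)
      fun M (p : ℕ × List (List ℕ)) => p.2 ∈ M.pull (S p.1) := by
  obtain ⟨σ, π, hl, hc, hS⟩ := h
  constructor
  · refine ⟨fun p => (σ p.1 (p.2.map List.length)).toBorel p.2.flatten,
      fun p => (hl _ _).1.toBorel _, fun hE => computable_label_toBorel (hc hE).1, fun M p => ?_⟩
    exact (hS _ _).1.trans (M.realize_iff_holds (σ p.1) p.2)
  · refine ⟨fun p => ((π p.1 (p.2.map List.length)).toBorel p.2.flatten).compl,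
      fun p => ((hl _ _).2.toBorel _).compl, fun hE => ?_, fun M p => ?_⟩
    · exact BorelCode.computable_label_compl
        (σ := fun p : ℕ × List (List ℕ) => (π p.1 (p.2.map List.length)).toBorel p.2.flatten)
        (computable_label_toBorel (hc hE).2)
    · rw [BorelCode.holds_compl]
      exact not_congr ((hS _ _).2.trans (M.realize_iff_holds (π p.1) p.2))

/-! ### Formulas in normal form -/

theorem Fml.HasLevel.mono {φ : Fml} {s : Bool} {α β : Ordinal.{0}} (h : φ.HasLevel s α)
    (hαβ : α ≤ β) : φ.HasLevel s β := by
  cases φ with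
  | leaf θ => trivial
  | disj ψ =>
    cases s with
    | false => exact h
    | true => exact fun k j => let ⟨γ, hγ, H⟩ := h k j; ⟨γ, hγ.trans_le hαβ, H⟩
  | conj ψ =>
    cases s with
    | true => exact h
    | false => exact fun k j => let ⟨γ, hγ, H⟩ := h k j; ⟨γ, hγ.trans_le hαβ, H⟩

theorem exists_ordinal_bound (f : ℕ → ℕ → Ordinal.{0}) : ∃ α, ∀ k j, f k j < α :=
  ⟨Order.succ (⨆ p : ℕ × ℕ, f p.1 p.2), fun k j =>
    Order.lt_succ_of_le (Ordinal.le_iSup (fun p : ℕ × ℕ => f p.1 p.2) (k, j))⟩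

/-- Every formula is equivalent to a formula of each of the two kinds, of some level. -/
theorem Fml.exists_hasLevel (φ : Fml) : ∃ α, ∀ s, ∃ φ' : Fml, φ'.HasLevel s α ∧
    ∀ {b : ℕ → ℕ} (M : Str b) (l : List ℕ), φ'.Realize M l ↔ φ.Realize M l := by
  have hfalse : ∀ {b : ℕ → ℕ} (M : Str b) (l : List ℕ), ¬ (leaf []).Realize M l := by
    intro b M l ⟨c, hc, _⟩
    exact List.not_mem_nil hc
  have htrue : ∀ {b : ℕ → ℕ} (M : Str b) (l : List ℕ), (leaf [[]]).Realize M l :=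
    fun M l => ⟨[], by simp⟩
  induction φ with
  | leaf θ => exact ⟨0, fun s => ⟨leaf θ, trivial, fun _ _ => Iff.rfl⟩⟩
  | disj ψ ih =>
    choose β ψ' h h' using fun k j => ih k j
    obtain ⟨α, hα⟩ := exists_ordinal_bound β
    -- Every disjunct is taken in its `Π` form, so that the disjunction is a `Σ` formula.
    have hσ : (disj fun k j => ψ' k j false).HasLevel true α := fun k j => ⟨_, hα k j, h k j _⟩
    have hσ' : ∀ {b : ℕ → ℕ} (M : Str b) (l : List ℕ),
        (disj fun k j => ψ' k j false).Realize M l ↔ (disj ψ).Realize M l := by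
      intro b M l
      simp only [Realize, h']
    refine ⟨Order.succ α, fun s => ?_⟩
    cases s with
    | true => exact ⟨_, hσ.mono (Order.le_succ α), hσ'⟩
    | false =>
      -- The other kind costs one level: a dummy conjunction, in which only the empty block carries
      -- the formula and all other blocks are true.
      refine ⟨conj fun k _ => if k = 0 then disj fun k j => ψ' k j false else leaf [[]],
        fun k j => ⟨α, Order.lt_succ α, ?_⟩, fun M l => ?_⟩
      · by_cases hk : k = 0 <;> simp only [hk, if_true, if_false]
        exacts [hσ, trivial]
      · rw [← hσ']
        constructor
        · intro H
          simpa using H [] 0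
        · intro H u j
          by_cases hk : u = []
          · simpa [hk] using H
          · simpa [hk] using htrue M _
  | conj ψ ih =>
    choose β ψ' h h' using fun k j => ih k j
    obtain ⟨α, hα⟩ := exists_ordinal_bound β
    have hπ : (conj fun k j => ψ' k j true).HasLevel false α := fun k j => ⟨_, hα k j, h k j _⟩
    have hπ' : ∀ {b : ℕ → ℕ} (M : Str b) (l : List ℕ),
        (conj fun k j => ψ' k j true).Realize M l ↔ (conj ψ).Realize M l := by
      intro b M l
      simp only [Realize, h']
    refine ⟨Order.succ α, fun s => ?_⟩
    cases s with
    | false => exact ⟨_, hπ.mono (Order.le_succ α), hπ'⟩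
    | true =>
      -- Dually, a dummy disjunction in which the nonempty blocks are false.
      refine ⟨disj fun k _ => if k = 0 then conj fun k j => ψ' k j true else leaf [],
        fun k j => ⟨α, Order.lt_succ α, ?_⟩, fun M l => ?_⟩
      · by_cases hk : k = 0 <;> simp only [hk, if_true, if_false]
        exacts [hπ, trivial]
      · rw [← hπ']
        constructor
        · rintro ⟨u, j, H⟩
          by_cases hk : u = []
          · simpa [hk] using H
          · exact (hfalse M _ (by simpa [hk] using H)).elim
        · intro H
          exact ⟨[], 0, by simpa using H⟩

/-- A family of relations that is definable by arbitrary formulas is definable at some level. -/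
theorem exists_deltaDefinable {b : ℕ → ℕ} (B : Str b) (S : ℕ → Set (List (List ℕ)))
    (φ : ℕ → List ℕ → Fml)
    (h : ∀ i L, L ∈ S i ↔ (φ i (L.map List.length)).Realize B L.flatten) :
    ∃ α, DeltaDefinable .boldface α B S := by
  choose β φ' hl hφ using fun i s => (φ i s).exists_hasLevel
  obtain ⟨α, hα⟩ := exists_ordinal_bound fun i j => β i (Denumerable.ofNat (List ℕ) j)
  have hα' : ∀ i s, β i s ≤ α := fun i s => by
    simpa using (hα i (Encodable.encode s)).le
  exact ⟨α, fun i s => φ' i s true, fun i s => φ' i s false,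
    fun i s => ⟨(hl i s true).mono (hα' i s), (hl i s false).mono (hα' i s)⟩, nofun,
    fun i L => ⟨(h i L).trans (hφ _ _ _ _ _).symm, (h i L).trans (hφ _ _ _ _ _).symm⟩⟩

theorem DeltaDefinable.mono {b : ℕ → ℕ} {B : Str b} {E : Face} {α β : Ordinal.{0}}
    {S : ℕ → Set (List (List ℕ))} (h : DeltaDefinable E α B S) (hαβ : α ≤ β) :
    DeltaDefinable E β B S := by
  obtain ⟨σ, π, hl, hc, hS⟩ := h
  exact ⟨σ, π, fun i s => ⟨(hl i s).1.mono hαβ, (hl i s).2.mono hαβ⟩, hc, hS⟩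

/-! ### The natural isomorphisms of a bi-interpretation -/

namespace Interp

variable {a b : ℕ → ℕ} {A : Str a} {B : Str b} (I : Interp A B)

theorem f_map_eq_iff {M : Str b} (h : Isom M B) {x y : List ℕ} (hx : I.Dom M x)
    (hy : I.Dom M y) : I.f (x.map h.toEquiv) = I.f (y.map h.toEquiv) ↔ I.Eqv M x y := by
  rw [I.f_eq_iff _ _ ((I.dom_map h x).1 hx) ((I.dom_map h y).1 hy), ← I.eqv_map h]

/-- The isomorphism of `F_I M` and `A` that is induced by an isomorphism of `M` and `B`. -/
noncomputable def objIso (M : IsoClass B) (h : Isom M.str B) : Isom (I.obj M).str A where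
  toEquiv := Equiv.ofBijective (fun n => I.f ((I.rep M.str n).map h.toEquiv)) <| by
    constructor
    · intro n m hnm
      exact I.rep_inj M ((I.f_map_eq_iff h (I.rep_dom M n) (I.rep_dom M m)).1 hnm)
    · intro n
      obtain ⟨x, hx, rfl⟩ := I.f_surj n
      have hx' : I.Dom M.str (x.map h.symm.toEquiv) := by
        rw [I.dom_map h, h.map_symm_map]; exact hx
      obtain ⟨m, hm⟩ := I.rep_surj M hx'
      refine ⟨m, ?_⟩
      have := (I.f_map_eq_iff h hx' (I.rep_dom M m)).2 hm
      rw [h.map_symm_map] at this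
      exact this.symm
  map_rel i k := by
    change I.Rel M.str i (k.map (I.rep M.str)) ↔
      k.map (fun n => I.f ((I.rep M.str n).map h.toEquiv)) ∈ A.rel i
    have hd : ∀ x ∈ (k.map (I.rep M.str)).map (List.map h.toEquiv), I.Dom B x := by
      intro x hx
      obtain ⟨y, hy, rfl⟩ := List.mem_map.1 hx
      obtain ⟨n, -, rfl⟩ := List.mem_map.1 hy
      exact (I.dom_map h _).1 (I.rep_dom M n)
    have hk : ((k.map (I.rep M.str)).map (List.map h.toEquiv)).map I.f =
        k.map (fun n => I.f ((I.rep M.str n).map h.toEquiv)) := by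
      simp [Function.comp_def]
    rw [I.rel_map h, ← hk]
    constructor
    · exact fun H => (I.f_rel i _ (I.rel_dom _ _ H).1 hd).1 H
    · exact fun H => (I.f_rel i _ (by simpa using A.length_eq _ _ H) hd).2 H

theorem objIso_apply (M : IsoClass B) (h : Isom M.str B) (n : ℕ) :
    (I.objIso M h).toEquiv n = I.f ((I.rep M.str n).map h.toEquiv) := rfl

/-- The tuple `τ(F(g)(n))` is equivalent to `g̃(τ(n))`, and `f` does not distinguish equivalent
tuples. So applying the functor to `g` amounts to changing the isomorphism with `B` by `g`. -/
theorem objIso_mapFun {M N : IsoClass B} (g : M ⟶ N) (h : Isom N.str B) (n : ℕ) :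
    (I.objIso N h).toEquiv (I.mapFun g n) = (I.objIso M (Isom.trans g h)).toEquiv n := by
  rw [objIso_apply, objIso_apply]
  have hd := (I.dom_map g _).1 (I.rep_dom M n)
  rw [← (I.f_map_eq_iff h hd (I.rep_dom N _)).2 (I.mapFun_spec g n), List.map_map]
  rfl

theorem map_trans_objIso {M N : IsoClass B} (g : M ⟶ N) (h : Isom N.str B) :
    Isom.trans (I.map g) (I.objIso N h) = I.objIso M (Isom.trans g h) :=
  Isom.ext (Equiv.ext fun n => I.objIso_mapFun g h n)

theorem map_rep_map_f (M : IsoClass B) (h : Isom M.str B) (w : List ℕ) :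
    ((w.map (I.rep M.str)).map (List.map h.toEquiv)).map I.f = w.map (I.objIso M h).toEquiv := by
  rw [List.map_map, List.map_map]; rfl

/-- Identifies, through `τ`, the domain of `J` in `F_I M` with a set definable in `M`.
Representatives lie in the domain of `I`, so only the condition on `J` remains. -/
theorem iterDom_map_rep (J : Interp B A) (M : IsoClass B) (h : Isom M.str B) (w : List ℕ) :
    I.IterDom J ((w.map (I.rep M.str)).map (List.map h.toEquiv)) ↔ J.Dom (I.obj M).str w := by
  rw [IterDom, map_rep_map_f, ← J.dom_map (I.objIso M h)]
  refine and_iff_right fun x hx => ?_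
  obtain ⟨y, hy, rfl⟩ := List.mem_map.1 hx
  obtain ⟨n, -, rfl⟩ := List.mem_map.1 hy
  exact (I.dom_map h _).1 (I.rep_dom M n)

end Interp

theorem compHolds_map {b : ℕ → ℕ} {M N : Str b} (h : Isom M N) (φ : List ℕ → Fml)
    (L : List (List ℕ)) (n : ℕ) :
    CompHolds φ M L n ↔ CompHolds φ N (L.map (List.map h.toEquiv)) (h.toEquiv n) := by
  have h1 : (L.map (List.map h.toEquiv)).map List.length = L.map List.length := by
    rw [List.map_map]; congr 1; funext l; simp
  rw [CompHolds, CompHolds, h1, Fml.realize_map h, List.map_append, List.map_flatten]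
  rfl

namespace BiInterp

variable {a b : ℕ → ℕ} {A : Str a} {B : Str b} (P : BiInterp A B)

/-- The bi-interpretation with the roles of the two structures exchanged. -/
def symm : BiInterp B A := ⟨P.J, P.I, P.compA, P.compB, P.compA_iff, P.compB_iff⟩

/-- The isomorphism of `F_J (F_I M)` and `M`, computed with an isomorphism of `M` and `B`. -/
noncomputable def counit (M : IsoClass B) (h : Isom M.str B) :
    Isom (P.J.obj (P.I.obj M)).str M.str :=
  (P.J.objIso (P.I.obj M) (P.I.objIso M h)).trans h.symm

theorem apply_counit (M : IsoClass B) (h : Isom M.str B) (m : ℕ) :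
    h.toEquiv ((P.counit M h).toEquiv m) =
      (P.J.objIso (P.I.obj M) (P.I.objIso M h)).toEquiv m :=
  Equiv.apply_symm_apply _ _

/-- Transport along `h` moves the question to `B`, where the formula defines the composition map.
The left side does not involve `h`, which is the source of `counit_eq`. -/
theorem compHolds_map_rep (M : IsoClass B) (h : Isom M.str B) (w : List ℕ) (n : ℕ) :
    CompHolds P.compB M.str (w.map (P.I.rep M.str)) n ↔ P.J.Dom (P.I.obj M).str w ∧
      P.J.f (w.map (P.I.objIso M h).toEquiv) = h.toEquiv n := by
  rw [compHolds_map h, P.compB_iff, P.I.iterDom_map_rep, P.I.map_rep_map_f]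

theorem compHolds_rep (M : IsoClass B) (h : Isom M.str B) (m n : ℕ) :
    CompHolds P.compB M.str ((P.J.rep (P.I.obj M).str m).map (P.I.rep M.str)) n ↔
      (P.counit M h).toEquiv m = n := by
  rw [P.compHolds_map_rep M h, and_iff_right (P.J.rep_dom (P.I.obj M) m),
    ← P.J.objIso_apply, ← P.apply_counit, h.toEquiv.apply_eq_iff_eq]

theorem counit_eq (M : IsoClass B) (h h' : Isom M.str B) : P.counit M h = P.counit M h' :=
  Isom.ext (Equiv.ext fun m =>
    ((P.compHolds_rep M h m _).1 ((P.compHolds_rep M h' m _).2 rfl)))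

/-- Since any isomorphism with `B` may be used, the one on `M` is taken to be `g` followed by `h'`;
then both sides have the same image in `B`. -/
theorem counit_naturality {M N : IsoClass B} (g : M ⟶ N) (h : Isom M.str B)
    (h' : Isom N.str B) (m : ℕ) :
    (P.counit N h').toEquiv (P.J.mapFun (P.I.map g) m) =
      (Isom.toEquiv g) ((P.counit M h).toEquiv m) := by
  apply h'.toEquiv.injective
  rw [P.apply_counit, P.J.objIso_mapFun, P.I.map_trans_objIso,
    P.counit_eq M h (Isom.trans g h')]
  exact (P.apply_counit M (Isom.trans g h') m).symm

/-- The natural isomorphism `η : 1 → F_J F_I`. -/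
noncomputable def unitIso : 𝟭 (IsoClass B) ≅ P.I.functor ⋙ P.J.functor :=
  NatIso.ofComponents
    (fun M =>
      { hom := (P.counit M M.iso).symm
        inv := P.counit M M.iso
        hom_inv_id := Isom.ext (Equiv.symm_trans_self _)
        inv_hom_id := Isom.ext (Equiv.self_trans_symm _) })
    (fun {M N} g => by
      refine Isom.ext (Equiv.ext fun n => ?_)
      change (P.counit N N.iso).toEquiv.symm ((Isom.toEquiv g) n) =
        P.J.mapFun (P.I.map g) ((P.counit M M.iso).toEquiv.symm n)
      rw [Equiv.symm_apply_eq, P.counit_naturality g M.iso N.iso, Equiv.apply_symm_apply])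

theorem unitIso_hom_app (M : IsoClass B) : P.unitIso.hom.app M = (P.counit M M.iso).symm := rfl

theorem unitIso_apply_eq_iff (M : IsoClass B) (n m : ℕ) :
    homEquiv (P.unitIso.hom.app M) n = m ↔
      CompHolds P.compB M.str ((P.J.rep (P.I.obj M).str m).map (P.I.rep M.str)) n := by
  rw [P.compHolds_rep M M.iso]
  exact (Equiv.symm_apply_eq _).trans eq_comm

theorem isBuiltFrom_unitIso : IsBuiltFrom P.I P.J P.compB P.unitIso := fun M n =>
  (P.unitIso_apply_eq_iff M n _).1 rfl

/-- It suffices to compare the inverses, and to do so after the injective map from `F_I M` to `A`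
induced by the chosen isomorphism of `M`. Both then become the isomorphism of `F_I F_J F_I M` with
`A` obtained by applying `objIso` three times. -/
theorem map_unitIso (M : IsoClass B) :
    P.I.functor.map (P.unitIso.hom.app M) = P.symm.unitIso.hom.app (P.I.functor.obj M) := by
  have key : P.symm.counit (P.I.obj M) (P.I.obj M).iso =
      P.I.map (M := P.J.obj (P.I.obj M)) (N := M) (P.counit M M.iso) := by
    -- Independence of the choice allows the induced isomorphism on `F_I M` in place of the
    -- arbitrary one.
    rw [P.symm.counit_eq _ _ (P.I.objIso M M.iso)]
    refine Isom.ext (Equiv.ext fun p => ?_)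
    apply (P.I.objIso M M.iso).toEquiv.injective
    rw [P.symm.apply_counit]
    refine Eq.trans ?_ (P.I.objIso_mapFun (M := P.J.obj (P.I.obj M)) (N := M)
      (P.counit M M.iso) M.iso p).symm
    have : P.J.objIso (P.I.obj M) (P.I.objIso M M.iso) =
        Isom.trans (P.counit M M.iso) M.iso :=
      Isom.ext (Equiv.ext fun m => (P.apply_counit M M.iso m).symm)
    rw [← this]
    rfl
  rw [unitIso_hom_app]
  refine Eq.trans ?_ (congrArg Isom.symm key).symm
  rfl

theorem isAdjointEquivalence :
    IsAdjointEquivalence P.I.functor P.J.functor P.unitIso P.symm.unitIso :=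
  ⟨P.map_unitIso, P.symm.map_unitIso⟩

end BiInterp

/-! ### Substitution of functions -/

namespace SigmaFam

variable {T I J K : Type} [Primcodable I] [Primcodable J] [Primcodable K] {E : Face}
  {α : Ordinal.{0}} {inp : T → ℕ → Bool} (hα : 1 ≤ α)
include hα

/-- `Y(k, r(i))` says that some `j` satisfies `r(i) = j` and `Y(k, j)`, so the level does not rise.
Applied to a relation and its negation this preserves `Δ⁰_α`. -/
theorem comp_fun {r : T → I → J} (hr : SigmaFam E α inp fun t (p : I × J) => r t p.1 = p.2)
    {Y : T → K × J → Prop} (hY : SigmaFam E α inp Y) :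
    SigmaFam E α inp fun t (k : K × I) => Y t (k.1, r t k.2) := by
  have g1 : Primrec fun q : (K × I) × J => (q.1.2, q.2) :=
    Primrec.pair (Primrec.snd.comp Primrec.fst) Primrec.snd
  have g2 : Primrec fun q : (K × I) × J => (q.1.1, q.2) :=
    Primrec.pair (Primrec.fst.comp Primrec.fst) Primrec.snd
  exact (((hr.reindex g1.to_comp).and hα (hY.reindex g2.to_comp)).exists_snd hα).congr
    fun t k => by simp

/-- As for a single value, but with a guess of the finite part of the graph of `r` above the list.
-/
theorem comp_map {r : T → I → J} (hr : SigmaFam E α inp fun t (p : I × J) => r t p.1 = p.2)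
    {Y : T → K × List J → Prop} (hY : SigmaFam E α inp Y) :
    SigmaFam E α inp fun t (k : K × List I) => Y t (k.1, k.2.map (r t)) := by
  classical
  have g1 : Primrec fun q : (K × List I) × List (I × J) => q.2.map Prod.fst :=
    Primrec.list_map Primrec.snd (Primrec.fst.comp Primrec.snd)
  have g2 : Primrec fun q : (K × List I) × List (I × J) => (q.1.1, q.2.map Prod.snd) :=
    Primrec.pair (Primrec.fst.comp Primrec.fst)
      (Primrec.list_map Primrec.snd (Primrec.snd.comp Primrec.snd))
  have h1 : PrimrecPred fun q : (K × List I) × List (I × J) => q.2.map Prod.fst = q.1.2 :=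
    Primrec.eq.comp g1 (Primrec.snd.comp Primrec.fst)
  have h2 : SigmaFam E α inp fun t (q : (K × List I) × List (I × J)) =>
      ∀ p ∈ q.2, r t p.1 = p.2 := hr.forall_mem hα Computable.snd
  refine (((decidable hα h1.decide.to_comp).and hα (h2.and hα
    (hY.reindex g2.to_comp))).exists_snd hα).congr fun t k => ?_
  constructor
  · intro H
    refine ⟨k.2.map fun i => (i, r t i), by simp [Function.comp_def], by simp, ?_⟩
    simpa [Function.comp_def] using H
  · rintro ⟨z, h, h', H⟩
    have e : z.map Prod.snd = (z.map Prod.fst).map (r t) := by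
      rw [List.map_map]
      exact List.map_congr_left fun p hp => (h' p hp).symm
    dsimp only at h h' H e
    rwa [e, h] at H

end SigmaFam

namespace DeltaFam

variable {T I J K : Type} [Primcodable I] [Primcodable J] [Primcodable K] {E : Face}
  {α : Ordinal.{0}} {inp : T → ℕ → Bool}

theorem congr {Y Z : T → I → Prop} (h : DeltaFam E α inp Y) (H : ∀ t i, Z t i ↔ Y t i) :
    DeltaFam E α inp Z :=
  ⟨h.1.congr H, h.2.congr fun t i => not_congr (H t i)⟩

theorem reindex {Y : T → I → Prop} (h : DeltaFam E α inp Y) {g : J → I} (hg : Computable g) :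
    DeltaFam E α inp fun t j => Y t (g j) :=
  ⟨h.1.reindex hg, h.2.reindex hg⟩

theorem comp_map (hα : 1 ≤ α) {r : T → I → J}
    (hr : SigmaFam E α inp fun t (p : I × J) => r t p.1 = p.2)
    {Y : T → K × List J → Prop} (hY : DeltaFam E α inp Y) :
    DeltaFam E α inp fun t (k : K × List I) => Y t (k.1, k.2.map (r t)) :=
  ⟨SigmaFam.comp_map hα hr hY.1, SigmaFam.comp_map hα hr hY.2⟩

theorem isDeltaOp_graphCode {f : T → ℕ → ℕ}
    (h : DeltaFam E α inp fun t (p : ℕ × ℕ) => f t p.1 = p.2) :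
    IsDeltaOp E α inp fun t => graphCode (f t) := by
  refine isDeltaOp ((h.reindex Computable.unpair).congr fun t n => ?_)
  simp [graphCode]

end DeltaFam

/-! ### The canonical bijection of an interpretation -/

namespace InterpFmls

variable {T : Type} {E : Face} {α : Ordinal.{0}} {inp : T → ℕ → Bool} {b : ℕ → ℕ}
  (S : InterpFmls) (K : T → Str b)

/-- Minimality in a class concerns only the finitely many smaller codes, so it is a finite
intersection and costs no level. -/
theorem deltaFam_isRep (hα : 1 ≤ α) (hd : DeltaFam E α inp fun t x => S.Dom (K t) x)
    (he : DeltaFam E α inp fun t (p : List ℕ × List ℕ) => S.Eqv (K t) p.1 p.2) :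
    DeltaFam E α inp fun t m => S.IsRep (K t) m := by
  have g : Primrec fun p : ℕ × ℕ =>
      (Denumerable.ofNat (List ℕ) p.2, Denumerable.ofNat (List ℕ) p.1) :=
    Primrec.pair (primrec_ofNat_list.comp Primrec.snd) (primrec_ofNat_list.comp Primrec.fst)
  have hd' := hd.reindex primrec_ofNat_list.to_comp
  have he' := he.reindex g.to_comp
  constructor
  · have gD : Primrec fun m : ℕ => (List.range m).map fun m' => (m, m') :=
      Primrec.list_map Primrec.list_range (Primrec.pair Primrec.fst Primrec.snd)
    exact (hd'.1.and hα (he'.2.forall_mem hα gD.to_comp)).congr fun t m => by simp [IsRep]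
  · have hlt : PrimrecPred fun p : ℕ × ℕ => p.2 < p.1 :=
      Primrec.nat_lt.comp Primrec.snd Primrec.fst
    refine (hd'.2.or hα (((SigmaFam.decidable hα hlt.decide.to_comp).and hα
      he'.1).exists_snd hα)).congr fun t m => ?_
    simp only [IsRep, not_and_or, not_forall, not_not, exists_prop]

/-- `τ(n) = x` means that the code of `x` is a representative with exactly `n` representatives below
it. A finite list `s` that decides which smaller codes are representatives certifies the count, and
checking `s` is a finite conjunction of `Δ⁰_α` facts. -/
theorem deltaFam_rep (hα : 1 ≤ α) (hd : DeltaFam E α inp fun t x => S.Dom (K t) x)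
    (he : DeltaFam E α inp fun t (p : List ℕ × List ℕ) => S.Eqv (K t) p.1 p.2)
    (hinf : ∀ t, (Set.ofPred (S.IsRep (K t))).Infinite) :
    SigmaFam E α inp fun t (p : ℕ × List ℕ) => S.rep (K t) p.1 = p.2 := by
  classical
  have hr := S.deltaFam_isRep K hα hd he
  have hs : SigmaFam E α inp fun t (p : ℕ × Bool) => (S.IsRep (K t) p.1 ↔ p.2 = true) :=
    SigmaFam.bool (hr.1.congr fun t m => by simp) (hr.2.congr fun t m => by simp)
  have pm : PrimrecRel fun (m : ℕ) (s : List ℕ) => m ∈ s := by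
    have h : PrimrecRel fun (s : List ℕ) (m : ℕ) => ∃ a ∈ s, a = m :=
      PrimrecRel.exists_mem_list Primrec.eq
    have h' : PrimrecRel fun (m : ℕ) (s : List ℕ) => ∃ a ∈ s, a = m :=
      h.comp Primrec.snd Primrec.fst
    exact h'.of_eq fun m s => by simp
  have g1 : Primrec fun q : (ℕ × List ℕ) × List ℕ => Encodable.encode q.1.2 :=
    Primrec.encode.comp (Primrec.snd.comp Primrec.fst)
  have g2 : Primrec fun q : (ℕ × List ℕ) × List ℕ =>
      (List.range (Encodable.encode q.1.2)).map fun j => (j, decide (j ∈ q.2)) :=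
    Primrec.list_map (Primrec.list_range.comp g1)
      (Primrec.pair Primrec.snd (pm.decide.comp Primrec.snd (Primrec.snd.comp Primrec.fst)))
  -- Counting inside the range makes repeated or too large entries of the guessed list harmless.
  have g3 : Primrec fun q : (ℕ × List ℕ) × List ℕ =>
      ((List.range (Encodable.encode q.1.2)).filter fun j => decide (j ∈ q.2)).length :=
    Primrec.list_length.comp ((PrimrecRel.listFilter pm).comp (Primrec.list_range.comp g1)
      Primrec.snd)
  have pc : PrimrecPred fun q : (ℕ × List ℕ) × List ℕ =>
      ((List.range (Encodable.encode q.1.2)).filter fun j => decide (j ∈ q.2)).length = q.1.1 :=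
    Primrec.eq.comp g3 (Primrec.fst.comp Primrec.fst)
  refine (((hr.1.reindex g1.to_comp).and hα ((SigmaFam.decidable hα pc.decide.to_comp).and hα
    (hs.forall_mem hα g2.to_comp))).exists_snd hα).congr fun t ⟨n, x⟩ => ?_
  have hcount : ∀ s : List ℕ, (∀ j < Encodable.encode x, (S.IsRep (K t) j ↔ j ∈ s)) →
      ((List.range (Encodable.encode x)).filter fun j => decide (j ∈ s)).length =
        Nat.count (S.IsRep (K t)) (Encodable.encode x) := by
    intro s H
    rw [Nat.count, List.countP_eq_length_filter]
    congr 1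
    refine List.filter_congr fun j hj => ?_
    simpa using (H j (List.mem_range.1 hj)).symm
  have hH : ∀ s : List ℕ, (∀ p ∈ (List.range (Encodable.encode x)).map fun j =>
      (j, decide (j ∈ s)), (S.IsRep (K t) p.1 ↔ p.2 = true)) ↔
        ∀ j < Encodable.encode x, (S.IsRep (K t) j ↔ j ∈ s) := by
    intro s
    simp
  constructor
  · intro h
    have hx : Encodable.encode x = Nat.nth (S.IsRep (K t)) n := by
      have h : S.rep (K t) n = x := h
      rw [← h, rep, Denumerable.encode_ofNat]
    have H : ∀ j < Encodable.encode x, (S.IsRep (K t) j ↔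
        j ∈ (List.range (Encodable.encode x)).filter fun j => decide (S.IsRep (K t) j)) := by
      intro j hj
      simp [hj]
    refine ⟨_, ?_, ?_, (hH _).2 H⟩
    · change S.IsRep (K t) (Encodable.encode x)
      rw [hx]
      exact Nat.nth_mem_of_infinite (hinf t) n
    · refine (hcount _ H).trans ?_
      rw [hx]
      exact Nat.count_nth_of_infinite (hinf t) n
  · rintro ⟨s, h1, h2, h3⟩
    have h2 := (hcount s ((hH s).1 h3)).symm.trans h2
    have h1 : S.IsRep (K t) (Encodable.encode x) := h1
    change S.rep (K t) n = x
    have h2 : Nat.count (S.IsRep (K t)) (Encodable.encode x) = n := h2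
    rw [rep, ← h2, Nat.nth_count h1, Denumerable.ofNat_encode]

end InterpFmls

/-! ### The complexity of the functor of an interpretation -/

theorem primrec_ofNat_nat_prod_list : Primrec (Denumerable.ofNat (ℕ × List ℕ)) :=
  (Primrec.option_getD.comp Primrec.decode (Primrec.const (0, []))).of_eq fun n => by
    rw [Denumerable.decode_eq_ofNat]; rfl

theorem cantorJoin_even (X Y : ℕ → Bool) (n : ℕ) : cantorJoin X Y (2 * n) = X n := by
  simp [cantorJoin]

theorem cantorJoin_odd (X Y : ℕ → Bool) (n : ℕ) : cantorJoin X Y (2 * n + 1) = Y n := by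
  have h1 : (2 * n + 1) % 2 = 1 := by omega
  have h2 : (2 * n + 1) / 2 = n := by omega
  simp [cantorJoin, h1, h2]

namespace Interp

variable {a b : ℕ → ℕ} {A : Str a} {B : Str b} {I : Interp A B} {E : Face} {α : Ordinal.{0}}

theorem IsDelta.dom (h : I.IsDelta E α) :
    DeltaFam E α (fun M : IsoClass B => M.str.code) fun M x => I.Dom M.str x := by
  have g : Primrec fun x : List ℕ => ((0, [x]) : ℕ × List (List ℕ)) :=
    Primrec.pair (Primrec.const 0) (Primrec.list_cons.comp Primrec.id (Primrec.const []))
  refine (h.deltaFam.reindex g.to_comp).congr fun M x => ?_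
  simp [IsoClass.pull, relations, I.dom_map M.iso]

theorem IsDelta.eqv (h : I.IsDelta E α) :
    DeltaFam E α (fun M : IsoClass B => M.str.code)
      fun M (p : List ℕ × List ℕ) => I.Eqv M.str p.1 p.2 := by
  have g : Primrec fun p : List ℕ × List ℕ => ((1, [p.1, p.2]) : ℕ × List (List ℕ)) :=
    Primrec.pair (Primrec.const 1) (Primrec.list_cons.comp Primrec.fst
      (Primrec.list_cons.comp Primrec.snd (Primrec.const [])))
  refine (h.deltaFam.reindex g.to_comp).congr fun M p => ?_
  rw [I.eqv_map M.iso]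
  constructor
  · exact fun H => ⟨_, _, rfl, H⟩
  · rintro ⟨x, y, hxy, H⟩
    simp only [List.map_cons, List.map_nil, List.cons.injEq, and_true] at hxy
    rwa [hxy.1, hxy.2]

theorem IsDelta.rel (h : I.IsDelta E α) :
    DeltaFam E α (fun M : IsoClass B => M.str.code)
      fun M (p : ℕ × List (List ℕ)) => I.Rel M.str p.1 p.2 := by
  have g : Primrec fun p : ℕ × List (List ℕ) => (p.1 + 2, p.2) :=
    Primrec.pair (Primrec.nat_add.comp Primrec.fst (Primrec.const 2)) Primrec.snd
  exact (h.deltaFam.reindex g.to_comp).congr fun M p => I.rel_map M.iso _ _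

theorem IsDelta.rep (hα : 1 ≤ α) (h : I.IsDelta E α) :
    SigmaFam E α (fun M : IsoClass B => M.str.code)
      fun M (p : ℕ × List ℕ) => I.rep M.str p.1 = p.2 :=
  I.deltaFam_rep (fun M : IsoClass B => M.str) hα h.dom h.eqv I.infinite_isRep

theorem IsDelta.isDeltaOp_obj (hα : 1 ≤ α) (h : I.IsDelta E α) :
    IsDeltaOp E α (fun M : IsoClass B => M.str.code) fun M => (I.functor.obj M).str.code := by
  refine DeltaFam.isDeltaOp (((h.rel.comp_map hα (h.rep hα)).reindex
    primrec_ofNat_nat_prod_list.to_comp).congr fun M n => ?_)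
  simp only [Str.code, decide_eq_true_eq]
  rfl

/-- `F(h)(n) = m` means `h̃(τ(n)) ∼ τ(m)`, with the two `τ` taken in source and target. Substituting
the three functions into `∼` gives a `Σ⁰_α` graph, and the graph of a total function is then `Δ⁰_α`.
-/
theorem IsDelta.isDeltaOp_map (hα : 1 ≤ α) (h : I.IsDelta E α) :
    IsDeltaOp E α (fun t : Mor B => t.code) fun t => graphCode (homEquiv (I.functor.map t.2.2)) := by
  -- In `M ⊕ (h ⊕ N)` bit `n` of `M` has position `2n`, that of `h` position `2(2n)+1`, and that of
  -- `N` position `2(2n+1)+1`.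
  have p0 : Primrec fun n : ℕ => 2 * n := Primrec.nat_mul.comp (Primrec.const 2) Primrec.id
  have p1 : Primrec fun n : ℕ => 2 * n + 1 := Primrec.succ.comp p0
  have pg : Primrec fun p : ℕ × ℕ => 2 * (2 * Nat.pair p.1 p.2) + 1 :=
    p1.comp (p0.comp (Primrec₂.natPair.comp Primrec.fst Primrec.snd))
  have hM : SigmaFam E α (fun t : Mor B => t.code)
      fun t (p : ℕ × List ℕ) => I.rep t.1.str p.1 = p.2 :=
    (h.rep hα).changeInput (fun t : Mor B => t.1) p0 fun t n => (cantorJoin_even _ _ n).symm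
  have hN : SigmaFam E α (fun t : Mor B => t.code)
      fun t (p : ℕ × List ℕ) => I.rep t.2.1.str p.1 = p.2 :=
    (h.rep hα).changeInput (fun t : Mor B => t.2.1) (p1.comp p1) fun t n =>
      ((cantorJoin_odd _ _ _).trans (cantorJoin_odd _ _ n)).symm
  have hE : SigmaFam E α (fun t : Mor B => t.code)
      fun t (p : List ℕ × List ℕ) => I.Eqv t.2.1.str p.2 p.1 :=
    (h.eqv.1.changeInput (fun t : Mor B => t.2.1) (p1.comp p1) fun t n =>
      ((cantorJoin_odd _ _ _).trans (cantorJoin_odd _ _ n)).symm).reindex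
        (g := fun p : List ℕ × List ℕ => (p.2, p.1)) (Primrec.pair Primrec.snd Primrec.fst).to_comp
  have hh : SigmaFam E α (fun t : Mor B => t.code)
      fun t (p : ℕ × ℕ) => homEquiv t.2.2 p.1 = p.2 := by
    refine ((SigmaFam.literal true).reindex pg.to_comp).congr fun t p => ?_
    rw [Mor.code, cantorJoin_odd, cantorJoin_even]
    simp [graphCode]
  have h1 := SigmaFam.comp_map hα hh hE
  have h2 := (SigmaFam.comp_fun hα hM h1).reindex (g := fun p : ℕ × List ℕ => (p.2, p.1))
    (Primrec.pair Primrec.snd Primrec.fst).to_comp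
  have h3 := SigmaFam.comp_fun hα hN h2
  refine DeltaFam.isDeltaOp_graphCode (DeltaFam.of_graph hα (h3.congr fun t p => ?_))
  constructor
  · rintro hp
    have := I.mapFun_spec t.2.2 p.1
    rwa [show I.mapFun t.2.2 p.1 = p.2 from hp] at this
  · exact fun H => I.mapFun_eq t.2.2 H

theorem IsDelta.isDeltaFunctor (hα : 1 ≤ α) (h : I.IsDelta E α) :
    IsDeltaFunctor E α I.functor :=
  ⟨h.isDeltaOp_obj hα, h.isDeltaOp_map hα⟩

theorem exists_isDelta (I : Interp A B) : ∃ α, I.IsDelta .boldface α := by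
  refine exists_deltaDefinable B _ (fun i s => match i, s with
    | 0, [k] => I.dom k
    | 1, [k, l] => I.eqv k l
    | i + 2, s => I.rel i s
    -- The relations numbered 0 and 1 contain only lists of one and two tuples; for other lengths
    -- the formula is false.
    | _, _ => .leaf []) fun i L => ?_
  have hfalse : ∀ l, ¬ (Fml.leaf []).Realize B l := fun l ⟨c, hc, _⟩ => List.not_mem_nil hc
  match i, L with
  | 0, [] => exact iff_of_false (by rintro ⟨x, hx, -⟩; simp at hx) (hfalse _)
  | 0, [x] => simp [relations, InterpFmls.Dom]
  | 0, x :: y :: L => exact iff_of_false (by rintro ⟨x, hx, -⟩; simp at hx) (hfalse _)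
  | 1, [] => exact iff_of_false (by rintro ⟨x, y, hx, -⟩; simp at hx) (hfalse _)
  | 1, [x] => exact iff_of_false (by rintro ⟨x, y, hx, -⟩; simp at hx) (hfalse _)
  | 1, [x, y] =>
    simp [relations, InterpFmls.Eqv]
  | 1, x :: y :: z :: L => exact iff_of_false (by rintro ⟨x, y, hx, -⟩; simp at hx) (hfalse _)
  | i + 2, L => rfl

end Interp

/-! ### The complexity of the natural isomorphisms -/

namespace BiInterp

variable {a b : ℕ → ℕ} {A : Str a} {B : Str b} {P : BiInterp A B} {E : Face} {α : Ordinal.{0}}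

/-- Evaluating the formulas of `J` in `F_I M` could raise the level. The domain of the composition
map is `Δ_α` in `M` itself, and its pull-back through `τ` is the set in question. -/
theorem deltaFam_dom (hα : 1 ≤ α) (h : P.I.IsDelta E α) (hc : P.I.CompIsDelta P.J E α) :
    DeltaFam E α (fun M : IsoClass B => M.str.code)
      fun M w => P.J.Dom (P.I.obj M).str w := by
  have g : Primrec fun w : List ℕ => (0, w) := Primrec.pair (Primrec.const 0) Primrec.id
  refine ((hc.1.deltaFam.comp_map hα (h.rep hα)).reindex g.to_comp).congr fun M w => ?_
  exact (P.I.iterDom_map_rep P.J M M.iso w).symm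

theorem deltaFam_compHolds (hα : 1 ≤ α) (h : P.I.IsDelta E α)
    (hc : P.I.CompIsDelta P.J E α) :
    DeltaFam E α (fun M : IsoClass B => M.str.code)
      fun M (p : ℕ × List ℕ) => CompHolds P.compB M.str (p.2.map (P.I.rep M.str)) p.1 := by
  have g : Primrec fun p : ℕ × List (List ℕ) => (0, p.2 ++ [[p.1]]) :=
    Primrec.pair (Primrec.const 0) (Primrec.list_append.comp Primrec.snd (Primrec.list_cons.comp
      (Primrec.list_cons.comp Primrec.fst (Primrec.const [])) (Primrec.const [])))
  have h1 : DeltaFam E α (fun M : IsoClass B => M.str.code)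
      fun M (p : ℕ × List (List ℕ)) => CompHolds P.compB M.str p.2 p.1 := by
    refine (hc.2.deltaFam.reindex g.to_comp).congr fun M p => ?_
    rw [compHolds_map M.iso, P.compB_iff]
    constructor
    · exact fun H => ⟨_, _, by simp, H.1, H.2⟩
    · rintro ⟨L, n, hL, H⟩
      rw [List.map_append] at hL
      -- Both lists end in one entry that holds the value, so the splitting is unique.
      obtain ⟨rfl, e⟩ := List.append_inj' hL rfl
      have : M.iso.toEquiv p.1 = n := by simpa using e
      rwa [this]
  exact h1.comp_map hα (h.rep hα)

/-- Equivalence is the kernel of the composition map, whose graph is `Δ⁰_α`: two tuples are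
equivalent if they share a value, and inequivalent if one lies outside the domain or they have
distinct values. Both descriptions are `Σ⁰_α`. -/
theorem deltaFam_eqv (hα : 1 ≤ α) (h : P.I.IsDelta E α) (hc : P.I.CompIsDelta P.J E α) :
    DeltaFam E α (fun M : IsoClass B => M.str.code)
      fun M (p : List ℕ × List ℕ) => P.J.Eqv (P.I.obj M).str p.1 p.2 := by
  have hd := deltaFam_dom hα h hc
  have hΓ := (deltaFam_compHolds hα h hc).1
  have key : ∀ (M : IsoClass B) (w : List ℕ), P.J.Dom (P.I.obj M).str w →
      ∃ n, ∀ n', CompHolds P.compB M.str (w.map (P.I.rep M.str)) n' ↔ n = n' := by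
    intro M w hw
    refine ⟨M.iso.toEquiv.symm (P.J.f (w.map (P.I.objIso M M.iso).toEquiv)), fun n' => ?_⟩
    rw [P.compHolds_map_rep M M.iso, and_iff_right hw, Equiv.symm_apply_eq]
  have hf : ∀ (M : IsoClass B) (w w' : List ℕ) (n n' : ℕ),
      CompHolds P.compB M.str (w.map (P.I.rep M.str)) n →
      CompHolds P.compB M.str (w'.map (P.I.rep M.str)) n' →
      (P.J.Eqv (P.I.obj M).str w w' ↔ n = n') := by
    intro M w w' n n' H H'
    rw [P.compHolds_map_rep M M.iso] at H H'
    rw [← P.J.f_map_eq_iff (P.I.objIso M M.iso) H.1 H'.1, H.2, H'.2,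
      M.iso.toEquiv.apply_eq_iff_eq]
  constructor
  · have g1 : Primrec fun q : (List ℕ × List ℕ) × ℕ => (q.2, q.1.1) :=
      Primrec.pair Primrec.snd (Primrec.fst.comp Primrec.fst)
    have g2 : Primrec fun q : (List ℕ × List ℕ) × ℕ => (q.2, q.1.2) :=
      Primrec.pair Primrec.snd (Primrec.snd.comp Primrec.fst)
    refine (((hΓ.reindex g1.to_comp).and hα (hΓ.reindex g2.to_comp)).exists_snd hα).congr
      fun M p => ?_
    constructor
    · intro H
      obtain ⟨hp, hp'⟩ := P.J.copy_eqv_dom (P.I.obj M) H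
      obtain ⟨n, hn⟩ := key M _ hp
      obtain ⟨n', hn'⟩ := key M _ hp'
      obtain rfl := (hf M _ _ _ _ ((hn n).2 rfl) ((hn' n').2 rfl)).1 H
      exact ⟨n, (hn n).2 rfl, (hn' n).2 rfl⟩
    · rintro ⟨n, H, H'⟩
      exact (hf M _ _ _ _ H H').2 rfl
  · have g1 : Primrec fun q : (List ℕ × List ℕ) × (ℕ × ℕ) => (q.2.1, q.1.1) :=
      Primrec.pair (Primrec.fst.comp Primrec.snd) (Primrec.fst.comp Primrec.fst)
    have g2 : Primrec fun q : (List ℕ × List ℕ) × (ℕ × ℕ) => (q.2.2, q.1.2) :=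
      Primrec.pair (Primrec.snd.comp Primrec.snd) (Primrec.snd.comp Primrec.fst)
    have hne : PrimrecPred fun q : (List ℕ × List ℕ) × (ℕ × ℕ) => ¬ q.2.1 = q.2.2 :=
      (Primrec.eq.comp (Primrec.fst.comp Primrec.snd) (Primrec.snd.comp Primrec.snd)).not
    refine ((hd.2.reindex Computable.fst).or hα ((hd.2.reindex Computable.snd).or hα
      (((SigmaFam.decidable hα hne.decide.to_comp).and hα ((hΓ.reindex g1.to_comp).and hα
        (hΓ.reindex g2.to_comp))).exists_snd hα))).congr fun M p => ?_
    constructor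
    · intro H
      refine or_iff_not_imp_left.2 fun hp => or_iff_not_imp_left.2 fun hp' => ?_
      obtain ⟨n, hn⟩ := key M _ (not_not.1 hp)
      obtain ⟨n', hn'⟩ := key M _ (not_not.1 hp')
      have h1 := (hn n).2 rfl
      have h2 := (hn' n').2 rfl
      exact ⟨(n, n'), fun e => H ((hf M _ _ _ _ h1 h2).2 e), h1, h2⟩
    · rintro (H | H | ⟨⟨n, n'⟩, hn, H, H'⟩) Heqv
      · exact H (P.J.copy_eqv_dom (P.I.obj M) Heqv).1
      · exact H (P.J.copy_eqv_dom (P.I.obj M) Heqv).2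
      · exact hn ((hf M _ _ _ _ H H').1 Heqv)

/-- The canonical bijection of `J` in `F_I M` has a `Σ⁰_α` graph over `M`, because its domain and
its equivalence are `Δ⁰_α` over `M`. Substituting it into the composition relation gives the graph
of `η`. -/
theorem isDeltaNatIso_unitIso (hα : 1 ≤ α) (h : P.I.IsDelta E α)
    (hc : P.I.CompIsDelta P.J E α) : IsDeltaNatIso E α P.unitIso := by
  have hr := P.J.deltaFam_rep (fun M : IsoClass B => (P.I.obj M).str) hα (deltaFam_dom hα h hc)
    (deltaFam_eqv hα h hc) fun M => P.J.infinite_isRep (P.I.obj M)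
  refine DeltaFam.isDeltaOp_graphCode (DeltaFam.of_graph hα
    ((SigmaFam.comp_fun hα hr (deltaFam_compHolds hα h hc).1).congr fun M p => ?_))
  exact P.unitIso_apply_eq_iff M p.1 p.2

theorem exists_compIsDelta (P : BiInterp A B) : ∃ α, P.I.CompIsDelta P.J .boldface α := by
  have hfalse : ∀ l, ¬ (Fml.leaf []).Realize B l := fun l ⟨c, hc, _⟩ => List.not_mem_nil hc
  obtain ⟨α, hα⟩ := exists_deltaDefinable B (fun _ => {L | P.I.IterDom P.J L})
    -- The domain is the projection of the graph; only blocks of one variable, the value,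
    -- contribute.
    (fun _ s => .disj fun k _ => if k = 1 then P.compB s else .leaf []) fun _ L => by
      constructor
      · intro H
        refine ⟨[P.J.f (L.map P.I.f)], 0, ?_⟩
        exact (P.compB_iff L _).2 ⟨H, rfl⟩
      · rintro ⟨u, j, H⟩
        by_cases hu : u.length = 1
        · obtain ⟨n, rfl⟩ := List.length_eq_one_iff.1 hu
          exact ((P.compB_iff L n).1 (by simpa [CompHolds] using H)).1
        · exact (hfalse _ (by simpa [hu] using H)).elim
  obtain ⟨β, hβ⟩ := exists_deltaDefinable B
    (fun _ => {K | ∃ L n, K = L ++ [[n]] ∧ P.I.IterDom P.J L ∧ P.J.f (L.map P.I.f) = n})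
    -- The last entry has to be the one-element tuple of the value; the defining formula is selected
    -- by the remaining lengths.
    (fun _ s => if s.getLast? = some 1 then P.compB s.dropLast else .leaf []) fun _ K => by
      constructor
      · rintro ⟨L, n, rfl, H⟩
        have := (P.compB_iff L n).2 H
        simpa [CompHolds] using this
      · intro H
        by_cases hK : (K.map List.length).getLast? = some 1
        · rcases List.eq_nil_or_concat K with rfl | ⟨L, x, rfl⟩
          · simp at hK
          · obtain ⟨n, rfl⟩ := List.length_eq_one_iff.1 (by simpa using hK : x.length = 1)
            refine ⟨L, n, by simp, (P.compB_iff L n).1 ?_⟩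
            simpa [CompHolds] using H
        · rw [if_neg hK] at H
          exact (hfalse _ H).elim
  exact ⟨max α β, hα.mono (le_max_left _ _), hβ.mono (le_max_right _ _)⟩

theorem exists_isDelta (P : BiInterp A B) : ∃ α, 1 ≤ α ∧ P.IsDelta .boldface α := by
  obtain ⟨α₁, h₁⟩ := P.I.exists_isDelta
  obtain ⟨α₂, h₂⟩ := P.J.exists_isDelta
  obtain ⟨α₃, h₃⟩ := P.exists_compIsDelta
  obtain ⟨α₄, h₄⟩ := P.symm.exists_compIsDelta
  refine ⟨max 1 (max (max α₁ α₂) (max α₃ α₄)), le_max_left _ _, h₁.mono ?_, h₂.mono ?_, ⟨h₃.1.mono ?_, h₃.2.mono ?_⟩,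
    ⟨h₄.1.mono ?_, h₄.2.mono ?_⟩⟩
  all_goals simp

/-- At a level `α ≥ 1` that bounds all formulas involved, the boldface `Δ⁰_α` operators are
available, and these are Borel. -/
theorem isBorelAdjointEquivalence (P : BiInterp A B) :
    IsBorelAdjointEquivalence P.I.functor P.J.functor P.unitIso P.symm.unitIso := by
  obtain ⟨α, hα, hI, hJ, hc, hc'⟩ := P.exists_isDelta
  have hF := hI.isDeltaFunctor hα
  have hG := hJ.isDeltaFunctor hα
  exact ⟨P.isAdjointEquivalence, ⟨hF.1.isBorelOp, hF.2.isBorelOp⟩,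
    ⟨hG.1.isBorelOp, hG.2.isBorelOp⟩, (isDeltaNatIso_unitIso hα hI hc).isBorelOp,
    (isDeltaNatIso_unitIso (P := P.symm) hα hJ hc').isBorelOp⟩

end BiInterp

theorem mainTheorem5 {a b : ℕ → ℕ} (A : Str a) (B : Str b) (P : BiInterp A B) :
    ∃ (η : 𝟭 (IsoClass B) ≅ P.I.functor ⋙ P.J.functor)
      (ε : 𝟭 (IsoClass A) ≅ P.J.functor ⋙ P.I.functor),
      IsBuiltFrom P.I P.J P.compB η ∧ IsBuiltFrom P.J P.I P.compA ε ∧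
      IsBorelAdjointEquivalence P.I.functor P.J.functor η ε ∧
      ∀ (E : Face) (α : Ordinal.{0}), 1 ≤ α →
        (P.I.IsDelta E α → IsDeltaFunctor E α P.I.functor) ∧
        (P.J.IsDelta E α → IsDeltaFunctor E α P.J.functor) ∧
        (P.IsDelta E α → IsDeltaNatIso E α η ∧ IsDeltaNatIso E α ε) :=
  ⟨P.unitIso, P.symm.unitIso, P.isBuiltFrom_unitIso, P.symm.isBuiltFrom_unitIso,
    P.isBorelAdjointEquivalence, fun _ _ hα => ⟨fun h => h.isDeltaFunctor hα,
      fun h => h.isDeltaFunctor hα, fun h =>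
        ⟨BiInterp.isDeltaNatIso_unitIso hα h.1 h.2.2.1,
          BiInterp.isDeltaNatIso_unitIso (P := P.symm) hα h.2.1 h.2.2.2⟩⟩⟩
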